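/- Let $P$ be a set of $n\ge 2$ points in the plane, no three of them collinear and no two of them on a horizontal line. For $\beta\in(0,\pi)$, an $\mathcal O_\beta$-quadrant is a translate of one of the four open regions (top-right, top-left, bottom-right, bottom-left) into which a horizontal line and a line of slope $\tan\beta$ divide the plane; it is $P$-free if it contains no point of $P$. The $\mathcal O_\beta$-hull $\mathcal O_\beta\mathcal H(P)$ is the plane minus the union of all $P$-free $\mathcal O_\beta$-quadrants. Its perimeter $\operatorname{perim}(\beta)$ is the length of its boundary, where the antennas of the hull (segments that form zero-area pieces of the hull) are counted twice, once for each side; that is, $\operatorname{perim}(\beta)=\mathcal H^1(\partial K)+\mathcal H^1(K\setminus\overline{\operatorname{int}K})$ with $K=\mathcal O_\beta\mathcal H(P)$. For each of the four types of quadrants, the vertices of the staircase of that type are the points of $P$ that are the apex of a $P$-free quadrant of that type; two vertices of a staircase that are consecutive with respect to height support a maximal quadrant of that type, having one of them on each of its two bounding rays. A non-empty intersection of two maximal quadrants of opposite types is an overlapping region, identified by its four supporting vertices. An event is an angle $\beta\in(0,\pi)$ at which a point joins or leaves the vertex set of a staircase, or at which an overlapping region is created or destroyed, i.e. an angle near which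 these sets are not all constant. Then the set of events and all the perimeters are finite, and: 1. The perimeter attains its maximum over $(0,\pi)$ at an event, and every $\beta\in(0,\pi)$ at which this maximum is attained is an event. 2. On every open interval $I\subseteq(0,\pi)$ that contains no event there are real constants $A,B,C$ with $B\ge 0$ such that $\operatorname{perim}(\beta)=A\cot\beta+B\csc\beta+C$ for all $\beta\in I$. Either $A=B=C=0$, or $B>0$; in the latter case a point $\beta\in I$ is critical for the perimeter if and only if $\cos\beta=-A/B$ (so there is at most one critical point in $I$), and no point of $I$, in particular not the critical one, is a local maximum of the perimeter. -/

import Mathlib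

open Set Filter Topology MeasureTheory

namespace OBeta

/-- The Euclidean plane; `w 0` and `w 1` are the Cartesian coordinates `x` and `y`. -/
abbrev Plane : Type := EuclideanSpace ℝ (Fin 2)

/-- The horizontal coordinate along the axes with slopes `0` and `tan β`: it is constant exactly
on the lines of slope `tan β` and increases to the right of them. -/
noncomputable def slantX (β : ℝ) (w : Plane) : ℝ := w 0 - w 1 * Real.cot β

/-- The four types of quadrants cut out by a horizontal line and a line of slope `tan β`. -/
inductive Corner
  | topRight
  | topLeft
  | bottomRight
  | bottomLeft

namespace Corner

/-- `1` for the quadrants to the right of the slanted line, `-1` for those to its left. -/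
def hSign : Corner → ℝ
  | topRight => 1
  | topLeft => -1
  | bottomRight => 1
  | bottomLeft => -1

/-- `1` for the quadrants above the horizontal line, `-1` for those below it. -/
def vSign : Corner → ℝ
  | topRight => 1
  | topLeft => 1
  | bottomRight => -1
  | bottomLeft => -1

/-- The type of the opposite quadrants. -/
def opposite : Corner → Corner
  | topRight => bottomLeft
  | topLeft => bottomRight
  | bottomRight => topLeft
  | bottomLeft => topRight

end Corner

/-- The open quadrant of type `X` with apex `z`. -/
def quadrant (β : ℝ) (X : Corner) (z : Plane) : Set Plane :=
  {w | 0 < X.hSign * (slantX β w - slantX β z) ∧ 0 < X.vSign * (w 1 - z 1)}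

/-- The set of all quadrants that contain no point of `P`. -/
def freeQuadrants (P : Finset Plane) (β : ℝ) : Set (Set Plane) :=
  {q | (∃ X z, q = quadrant β X z) ∧ ∀ p ∈ P, p ∉ q}

/-- The `O_β`-hull of `P`: the plane minus all `P`-free quadrants. -/
def hull (P : Finset Plane) (β : ℝ) : Set Plane := (⋃₀ freeQuadrants P β)ᶜ

/-- The zero-area part of the hull, i.e. its antennas (degenerate, one-dimensional pieces of the
hull) and isolated points: the points that are not limits of interior points of the hull. -/
def thinPart (P : Finset Plane) (β : ℝ) : Set Plane :=
  hull P β \ closure (interior (hull P β))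

/-- The length, in `[0, ∞]`, of the boundary of the hull, where the antennas, which have the
exterior of the hull on both of their sides, are traversed by the boundary twice. -/
noncomputable def boundaryLength (P : Finset Plane) (β : ℝ) : ENNReal :=
  Measure.hausdorffMeasure 1 (frontier (hull P β)) +
    Measure.hausdorffMeasure 1 (thinPart P β)

/-- The perimeter of the hull. -/
noncomputable def perim (P : Finset Plane) (β : ℝ) : ℝ := (boundaryLength P β).toReal

/-- The vertices on the staircase of type `X`: the points of `P` that are the apex of a `P`-free
quadrant of type `X`. -/
def vertices (P : Finset Plane) (β : ℝ) (X : Corner) : Set Plane :=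
  {p | p ∈ P ∧ ∀ r ∈ P, r ∉ quadrant β X p}

/-- `p` (the lower one) and `q` are consecutive vertices on the staircase of type `X`. Staircases
are monotone, so that their vertices are met in the order of their heights. -/
def Consecutive (P : Finset Plane) (β : ℝ) (X : Corner) (p q : Plane) : Prop :=
  p ∈ vertices P β X ∧ q ∈ vertices P β X ∧ p 1 < q 1 ∧
    ∀ r ∈ vertices P β X, ¬ (p 1 < r 1 ∧ r 1 < q 1)

/-- The quadrant of type `X` supported by `p` and `q`, i.e. the largest one with `p` and `q`
on the two rays of its boundary; it is maximal if `p` and `q` are consecutive vertices on the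
staircase of type `X`. -/
def supportedQuadrant (β : ℝ) (X : Corner) (p q : Plane) : Set Plane :=
  {w | min (X.hSign * slantX β p) (X.hSign * slantX β q) < X.hSign * slantX β w ∧
    min (X.vSign * p 1) (X.vSign * q 1) < X.vSign * w 1}

/-- The overlapping regions between the staircase of type `X` and the opposite one, recorded by the
vertices `((p, q), (r, s))` that support the two overlapping maximal quadrants. -/
def overlaps (P : Finset Plane) (β : ℝ) (X : Corner) : Set ((Plane × Plane) × (Plane × Plane)) :=
  {t | Consecutive P β X t.1.1 t.1.2 ∧ Consecutive P β X.opposite t.2.1 t.2.2 ∧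
    (supportedQuadrant β X t.1.1 t.1.2 ∩
      supportedQuadrant β X.opposite t.2.1 t.2.2).Nonempty}

/-- Insertion or deletion event: a point joins or leaves one of the four staircases at `β`. -/
def IsVertexEvent (P : Finset Plane) (β : ℝ) : Prop :=
  ∃ X, ¬ ∀ᶠ γ in 𝓝 β, vertices P γ X = vertices P β X

/-- Overlap or release event: an overlapping region is created or destroyed at `β`. -/
def IsOverlapEvent (P : Finset Plane) (β : ℝ) : Prop :=
  ∃ X, ¬ ∀ᶠ γ in 𝓝 β, overlaps P γ X = overlaps P β X

/-- The event angles in `(0, π)`. -/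
def events (P : Finset Plane) : Set ℝ :=
  {β | β ∈ Ioo 0 Real.pi ∧ (IsVertexEvent P β ∨ IsOverlapEvent P β)}

end OBeta

/-! In the oblique coordinates `slantX β` and `slantY β`, a point lies in the hull exactly when each
of its four closed quadrants meets `P` (`mem_hull_iff`). A nonempty row of this set at a height that
is not the height of a point of `P` is a compact interval. Its frontier points are the two ends, and
the hull is thin there exactly when the ends coincide. Since the thin part is counted twice,
inclusion-exclusion gives every such row the weight 2, and the same holds for columns. So the
perimeter is twice the sum of the lengths of the two oblique projections, the "shadows"
(`measure_boundary`, `boundaryLength_eq`).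

A column between the extreme points misses the hull exactly when all points of `P` on one side of it
are strictly higher than all those on the other, and such columns form the interiors of the
overlapping regions (`gap_iff`). The horizontal shadow thus has the extent of `P` minus the widths
of the overlaps as its length (`volume_shadow`), and the set of heights in the other shadow depends
on `β` only through the overlaps (`shadow_swap_congr`).

Between events the extreme points and the overlaps are fixed. The first length is then affine in
`cot β`, and the second is a constant times `csc β`; this is `exists_perim_formula`. If that
constant is zero, the hull has no width either (`volume_shadow_eq_zero`), so the perimeter vanishes
on the interval. Otherwise the derivative `-(A + B cos β) / sin² β` changes sign from negative to
positive at its only possible zero, so there is no local maximum.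

The maximum exists because the length is upper semicontinuous and vanishes for directions close to
the horizontal. It is positive, as the direction of a line through two points shows, so it can only
be attained at an event. Events are finite in number, because each of them needs a slanted line
through two points of `P`. -/

namespace OBeta

/-! ### Boundary length of an orthogonal hull through its projections -/

section Planar

variable {α : Type*} (P : Finset α) (f g : α → ℝ)

/-- The orthogonal hull, in coordinates `(f, g)`: all four closed quadrants at each of its points
meet `P`. -/
def orthoHull : Set (ℝ × ℝ) :=
  {w | (∃ x ∈ P, f x ≤ w.1 ∧ g x ≤ w.2) ∧ (∃ x ∈ P, f x ≤ w.1 ∧ w.2 ≤ g x) ∧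
    (∃ x ∈ P, w.1 ≤ f x ∧ g x ≤ w.2) ∧ (∃ x ∈ P, w.1 ≤ f x ∧ w.2 ≤ g x)}

/-- The projection of the orthogonal hull to the first coordinate axis. -/
def shadow : Set ℝ :=
  {a | (∃ x ∈ P, ∃ y ∈ P, f y ≤ a ∧ a ≤ f x ∧ g x ≤ g y) ∧
    (∃ x ∈ P, ∃ y ∈ P, f y ≤ a ∧ a ≤ f x ∧ g y ≤ g x)}

variable {P f g}

theorem swap_mem_orthoHull {a b : ℝ} :
    (a, b) ∈ orthoHull P g f ↔ (b, a) ∈ orthoHull P f g := by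
  simp only [orthoHull, mem_ofPred_eq]
  constructor
  · rintro ⟨⟨x, hx, h1, h2⟩, ⟨y, hy, h3, h4⟩, ⟨z, hz, h5, h6⟩, ⟨w, hw, h7, h8⟩⟩
    exact ⟨⟨x, hx, h2, h1⟩, ⟨z, hz, h6, h5⟩, ⟨y, hy, h4, h3⟩, ⟨w, hw, h8, h7⟩⟩
  · rintro ⟨⟨x, hx, h1, h2⟩, ⟨y, hy, h3, h4⟩, ⟨z, hz, h5, h6⟩, ⟨w, hw, h7, h8⟩⟩
    exact ⟨⟨x, hx, h2, h1⟩, ⟨z, hz, h6, h5⟩, ⟨y, hy, h4, h3⟩, ⟨w, hw, h8, h7⟩⟩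

/-- The column at `a` is the intersection of the range of `g` over the points on the left with the
range over those on the right. The two conditions in `shadow` say that neither range lies strictly
beyond the other. The larger of the two lower ends is then a common value. -/
theorem mem_shadow_iff {a : ℝ} : a ∈ shadow P f g ↔ ∃ b, (a, b) ∈ orthoHull P f g := by
  constructor
  · rintro ⟨⟨x, hx, y, hy, h1, h2, h3⟩, ⟨x', hx', y', hy', h4, h5, h6⟩⟩
    refine ⟨max (min (g y) (g y')) (min (g x) (g x')), ?_, ?_, ?_, ?_⟩
    · rcases le_total (g y) (g y') with h | h
      · exact ⟨y, hy, h1, by simp [h]⟩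
      · exact ⟨y', hy', h4, by simp [h]⟩
    · rcases le_total (g y) (g y') with h | h
      · exact ⟨y', hy', h4, by simp [h, h3.trans h]⟩
      · exact ⟨y, hy, h1, by simp [h, h3]⟩
    · rcases le_total (g x) (g x') with h | h
      · exact ⟨x, hx, h2, by simp [h]⟩
      · exact ⟨x', hx', h5, by simp [h]⟩
    · rcases le_total (g x) (g x') with h | h
      · exact ⟨x', hx', h5, by simp [h, h6]⟩
      · exact ⟨x, hx, h2, by simp [h, h6.trans h]⟩
  · rintro ⟨b, ⟨x, hx, h1, h2⟩, ⟨y, hy, h3, h4⟩, ⟨z, hz, h5, h6⟩, ⟨w, hw, h7, h8⟩⟩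
    exact ⟨⟨z, hz, y, hy, h3, h5, h6.trans h4⟩, ⟨w, hw, x, hx, h1, h7, h2.trans h8⟩⟩

theorem mem_shadow_swap_iff {b : ℝ} : b ∈ shadow P g f ↔ ∃ a, (a, b) ∈ orthoHull P f g := by
  simp only [mem_shadow_iff, swap_mem_orthoHull]

theorem isClosed_orthoHull : IsClosed (orthoHull P f g) := by
  have key : ∀ Q : α → ℝ × ℝ → Prop, (∀ x, IsClosed {w | Q x w}) →
      IsClosed {w | ∃ x ∈ P, Q x w} := by
    intro Q hQ
    have : {w | ∃ x ∈ P, Q x w} = ⋃ x ∈ P, {w | Q x w} := by ext; simp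
    rw [this]
    exact isClosed_biUnion_finset fun x _ => hQ x
  refine (key _ fun x => ?_).inter ((key _ fun x => ?_).inter
    ((key _ fun x => ?_).inter (key _ fun x => ?_)))
  · exact (isClosed_le continuous_const continuous_fst).inter
      (isClosed_le continuous_const continuous_snd)
  · exact (isClosed_le continuous_const continuous_fst).inter
      (isClosed_le continuous_snd continuous_const)
  · exact (isClosed_le continuous_fst continuous_const).inter
      (isClosed_le continuous_const continuous_snd)
  · exact (isClosed_le continuous_fst continuous_const).inter
      (isClosed_le continuous_snd continuous_const)

/-- Heights that are not separated from `v` by the height of a point of `P`. -/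
theorem eventually_same_side (P : Finset α) (g : α → ℝ) (v : ℝ) :
    ∀ᶠ b in 𝓝 v, ∀ x ∈ P, (v < g x → b < g x) ∧ (g x < v → g x < b) := by
  rw [Filter.eventually_all_finset]
  intro x _
  refine Filter.Eventually.and ?_ ?_
  · by_cases h : v < g x
    · filter_upwards [eventually_lt_nhds h] with b hb _ using hb
    · exact Eventually.of_forall fun b h' => absurd h' h
  · by_cases h : g x < v
    · filter_upwards [eventually_gt_nhds h] with b hb _ using hb
    · exact Eventually.of_forall fun b h' => absurd h' h

theorem eventually_row_iff {v : ℝ} (hv : v ∉ g '' P) :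
    ∀ᶠ b in 𝓝 v, ∀ a, (a, b) ∈ orthoHull P f g ↔ (a, v) ∈ orthoHull P f g := by
  filter_upwards [eventually_same_side P g v] with b hb a
  have h1 : ∀ x ∈ P, (g x ≤ b ↔ g x ≤ v) := by
    intro x hx
    have hne : g x ≠ v := fun h => hv ⟨x, hx, h⟩
    rcases lt_or_gt_of_ne hne with h | h
    · exact ⟨fun _ => h.le, fun _ => ((hb x hx).2 h).le⟩
    · exact ⟨fun h' => absurd ((hb x hx).1 h) h'.not_gt, fun h' => absurd h h'.not_gt⟩
  have h2 : ∀ x ∈ P, (b ≤ g x ↔ v ≤ g x) := by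
    intro x hx
    have hne : g x ≠ v := fun h => hv ⟨x, hx, h⟩
    rcases lt_or_gt_of_ne hne with h | h
    · exact ⟨fun h' => absurd ((hb x hx).2 h) h'.not_gt, fun h' => absurd h h'.not_gt⟩
    · exact ⟨fun _ => h.le, fun _ => ((hb x hx).1 h).le⟩
  have e : ∀ (R : α → Prop) (S T : α → Prop), (∀ x ∈ P, (S x ↔ T x)) →
      ((∃ x ∈ P, R x ∧ S x) ↔ ∃ x ∈ P, R x ∧ T x) := by
    intro R S T h
    exact exists_congr fun x => and_congr_right fun hx => and_congr_right fun _ => h x hx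
  simp only [orthoHull, mem_ofPred_eq]
  rw [e _ _ _ h1, e _ _ _ h2, e _ _ _ h1, e _ _ _ h2]

variable (P f g)

/-- The left ends of those rows of the hull that contain no point of `P`. -/
def leftEnds : Set (ℝ × ℝ) :=
  {w | w ∈ orthoHull P f g ∧ w.2 ∉ g '' P ∧ ∀ a, (a, w.2) ∈ orthoHull P f g → w.1 ≤ a}

/-- The right ends of those rows of the hull that contain no point of `P`. -/
def rightEnds : Set (ℝ × ℝ) :=
  {w | w ∈ orthoHull P f g ∧ w.2 ∉ g '' P ∧ ∀ a, (a, w.2) ∈ orthoHull P f g → a ≤ w.1}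

variable {P f g}

/-- Rows are convex: `h₁` supplies the witnesses on the left and `h₂` those on the right. Nearby
rows coincide with the row at `v`, which gives room in the vertical direction. -/
theorem mem_interior_orthoHull {a₁ a₂ a v : ℝ} (hv : v ∉ g '' P)
    (h₁ : (a₁, v) ∈ orthoHull P f g) (h₂ : (a₂, v) ∈ orthoHull P f g) (ha₁ : a₁ < a)
    (ha₂ : a < a₂) : (a, v) ∈ interior (orthoHull P f g) := by
  rw [mem_interior_iff_mem_nhds, nhds_prod_eq]
  filter_upwards [((eventually_gt_nhds ha₁).and (eventually_lt_nhds ha₂)).prod_mk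
    (eventually_row_iff (f := f) hv)] with w hw
  obtain ⟨⟨hw1, hw2⟩, hw3⟩ := hw
  have : (w.1, v) ∈ orthoHull P f g := by
    obtain ⟨⟨x, hx, h1, h2⟩, ⟨y, hy, h3, h4⟩, -, -⟩ := h₁
    obtain ⟨-, -, ⟨x', hx', h1', h2'⟩, ⟨y', hy', h3', h4'⟩⟩ := h₂
    exact ⟨⟨x, hx, h1.trans hw1.le, h2⟩, ⟨y, hy, h3.trans hw1.le, h4⟩,
      ⟨x', hx', hw2.le.trans h1', h2'⟩, ⟨y', hy', hw2.le.trans h3', h4'⟩⟩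
  exact (hw3 w.1).2 this

theorem exists_row_of_mem_interior {w : ℝ × ℝ} (hw : w ∈ interior (orthoHull P f g)) :
    ∃ a₁ a₂, a₁ < w.1 ∧ w.1 < a₂ ∧ (a₁, w.2) ∈ orthoHull P f g ∧
      (a₂, w.2) ∈ orthoHull P f g := by
  have hc : Tendsto (fun t : ℝ => (t, w.2)) (𝓝 w.1) (𝓝 w) :=
    (Continuous.prodMk_left w.2).tendsto w.1
  have h := hc.eventually (mem_interior_iff_mem_nhds.1 hw)
  obtain ⟨ε, hε, h⟩ := Metric.eventually_nhds_iff.1 h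
  refine ⟨w.1 - ε / 2, w.1 + ε / 2, by linarith, by linarith, h ?_, h ?_⟩
  · rw [Real.dist_eq, abs_lt]; constructor <;> linarith
  · rw [Real.dist_eq, abs_lt]; constructor <;> linarith

theorem frontier_inter_rows :
    frontier (orthoHull P f g) ∩ {w | w.2 ∉ g '' P} = leftEnds P f g ∪ rightEnds P f g := by
  rw [isClosed_orthoHull.frontier_eq]
  ext ⟨a, v⟩
  constructor
  · rintro ⟨⟨hK, hi⟩, hv⟩
    by_contra hcon
    simp only [leftEnds, rightEnds, mem_union, mem_ofPred_eq, not_or, not_and, not_forall,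
      not_le] at hcon
    obtain ⟨a₁, h₁, h₁'⟩ := hcon.1 hK hv
    obtain ⟨a₂, h₂, h₂'⟩ := hcon.2 hK hv
    exact hi (mem_interior_orthoHull hv h₁ h₂ h₁' h₂')
  · rintro (⟨hK, hv, h⟩ | ⟨hK, hv, h⟩)
    · refine ⟨⟨hK, fun hi => ?_⟩, hv⟩
      obtain ⟨a₁, a₂, h1, h2, h3, h4⟩ := exists_row_of_mem_interior hi
      exact absurd (h _ h3) (not_le.2 h1)
    · refine ⟨⟨hK, fun hi => ?_⟩, hv⟩
      obtain ⟨a₁, a₂, h1, h2, h3, h4⟩ := exists_row_of_mem_interior hi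
      exact absurd (h _ h4) (not_le.2 h2)

theorem thin_inter_rows :
    (orthoHull P f g \ closure (interior (orthoHull P f g))) ∩ {w | w.2 ∉ g '' P} =
      leftEnds P f g ∩ rightEnds P f g := by
  have tend : ∀ a v : ℝ, Tendsto (fun t : ℝ => (t, v)) (𝓝 a) (𝓝 (a, v)) := fun a v =>
    (Continuous.prodMk_left v).tendsto a
  ext ⟨a, v⟩
  constructor
  · rintro ⟨⟨hK, hi⟩, hv⟩
    refine ⟨⟨hK, hv, fun a' h' => ?_⟩, ⟨hK, hv, fun a' h' => ?_⟩⟩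
    · by_contra! hlt
      simp only at hlt
      refine hi (mem_closure_of_tendsto ((tend a v).mono_left (nhdsWithin_le_nhds (s := Iio a)))
        ?_)
      filter_upwards [Ioo_mem_nhdsLT hlt] with t ht
      exact mem_interior_orthoHull hv h' hK ht.1 ht.2
    · by_contra! hlt
      simp only at hlt
      refine hi (mem_closure_of_tendsto ((tend a v).mono_left (nhdsWithin_le_nhds (s := Ioi a)))
        ?_)
      filter_upwards [Ioo_mem_nhdsGT hlt] with t ht
      exact mem_interior_orthoHull hv hK h' ht.1 ht.2
  · rintro ⟨⟨hK, hv, hl⟩, ⟨-, -, hr⟩⟩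
    refine ⟨⟨hK, fun hi => ?_⟩, hv⟩
    have hrow : ∀ᶠ w : ℝ × ℝ in 𝓝 (a, v), ∀ c, (c, w.2) ∈ orthoHull P f g ↔
        (c, v) ∈ orthoHull P f g := by
      have := (continuous_snd.tendsto (a, v)).eventually (eventually_row_iff (P := P) (f := f) hv)
      exact this
    obtain ⟨w, hw1, hw2⟩ := mem_closure_iff_nhds.1 hi _ hrow
    obtain ⟨a₁, a₂, h1, h2, h3, h4⟩ := exists_row_of_mem_interior hw2
    have e1 := hl _ ((hw1 a₁).1 h3)
    have e2 := hr _ ((hw1 a₂).1 h4)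
    simp only at e1 e2
    linarith

/-- Otherwise a small move to the left crosses no point of `P` and stays in the hull, against
minimality. -/
theorem leftEnds_fst {w : ℝ × ℝ} (hw : w ∈ leftEnds P f g) : w.1 ∈ f '' P := by
  obtain ⟨hK, hv, h⟩ := hw
  by_contra hcon
  have hev := (eventually_same_side P f w.1).filter_mono (nhdsWithin_le_nhds (s := Iio w.1))
  obtain ⟨a, ha, hlt⟩ := (hev.and self_mem_nhdsWithin).exists
  have key : ∀ x ∈ P, f x ≤ w.1 → f x ≤ a := fun x hx hle =>
    ((ha x hx).2 (lt_of_le_of_ne hle fun e => hcon ⟨x, hx, e⟩)).le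
  have hlt : a < w.1 := hlt
  refine absurd (h a ?_) (not_le.2 hlt)
  obtain ⟨⟨x, hx, h1, h2⟩, ⟨y, hy, h3, h4⟩, ⟨z, hz, h5, h6⟩, ⟨w', hw, h7, h8⟩⟩ := hK
  exact ⟨⟨x, hx, key x hx h1, h2⟩, ⟨y, hy, key y hy h3, h4⟩, ⟨z, hz, hlt.le.trans h5, h6⟩,
    ⟨w', hw, hlt.le.trans h7, h8⟩⟩

theorem rightEnds_fst {w : ℝ × ℝ} (hw : w ∈ rightEnds P f g) : w.1 ∈ f '' P := by
  obtain ⟨hK, hv, h⟩ := hw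
  by_contra hcon
  have hev := (eventually_same_side P f w.1).filter_mono (nhdsWithin_le_nhds (s := Ioi w.1))
  obtain ⟨a, ha, hlt⟩ := (hev.and self_mem_nhdsWithin).exists
  have key : ∀ x ∈ P, w.1 ≤ f x → a ≤ f x := fun x hx hle =>
    ((ha x hx).1 (lt_of_le_of_ne hle fun e => hcon ⟨x, hx, e.symm⟩)).le
  have hlt : w.1 < a := hlt
  refine absurd (h a ?_) (not_le.2 hlt)
  obtain ⟨⟨x, hx, h1, h2⟩, ⟨y, hy, h3, h4⟩, ⟨z, hz, h5, h6⟩, ⟨w', hw, h7, h8⟩⟩ := hK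
  exact ⟨⟨x, hx, h1.trans hlt.le, h2⟩, ⟨y, hy, h3.trans hlt.le, h4⟩, ⟨z, hz, key z hz h5, h6⟩,
    ⟨w', hw, key w' hw h7, h8⟩⟩

theorem isCompact_row (v : ℝ) : IsCompact {a | (a, v) ∈ orthoHull P f g} := by
  obtain ⟨m, hm⟩ := (P.finite_toSet.image f).bddBelow
  obtain ⟨M, hM⟩ := (P.finite_toSet.image f).bddAbove
  refine (isCompact_Icc (a := m) (b := M)).of_isClosed_subset
    (isClosed_orthoHull.preimage (Continuous.prodMk_left v)) ?_
  rintro a ⟨⟨x, hx, h1, -⟩, -, ⟨y, hy, h2, -⟩, -⟩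
  exact ⟨(hm ⟨x, hx, rfl⟩).trans h1, h2.trans (hM ⟨y, hy, rfl⟩)⟩

theorem isOpen_rows_of_ends {E : Set (ℝ × ℝ)}
    (hE : E = leftEnds P f g ∨ E = rightEnds P f g) (c : ℝ) : IsOpen {v | (c, v) ∈ E} := by
  rw [isOpen_iff_mem_nhds]
  intro v hv
  have hv' : v ∉ g '' P := by rcases hE with rfl | rfl <;> exact hv.2.1
  have h1 : ∀ᶠ b in 𝓝 v, b ∉ g '' P :=
    (P.finite_toSet.image g).isClosed.isOpen_compl.mem_nhds hv'
  filter_upwards [h1, eventually_row_iff (P := P) (f := f) hv'] with b hb hrow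
  rcases hE with rfl | rfl
  · exact ⟨(hrow c).2 hv.1, hb, fun a ha => hv.2.2 a ((hrow a).1 ha)⟩
  · exact ⟨(hrow c).2 hv.1, hb, fun a ha => hv.2.2 a ((hrow a).1 ha)⟩

/-- A set with a finite first projection and open columns that is the graph of a function of the
second coordinate has the length of its second projection. -/
theorem measure_graph (ν : Measure (ℝ × ℝ))
    (h₁ : ∀ (c : ℝ) (S : Set ℝ), MeasurableSet S → ν ({c} ×ˢ S) = volume S)
    {E : Set (ℝ × ℝ)} {F : Set ℝ} (hF : F.Finite) (hEF : ∀ w ∈ E, w.1 ∈ F)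
    (hopen : ∀ c, IsOpen {v | (c, v) ∈ E})
    (hgraph : ∀ c c' v, (c, v) ∈ E → (c', v) ∈ E → c = c') :
    MeasurableSet E ∧ ν E = volume (Prod.snd '' E) := by
  have hE : E = ⋃ c ∈ F, ({c} ×ˢ {v | (c, v) ∈ E} : Set (ℝ × ℝ)) := by
    ext ⟨a, v⟩
    simp only [mem_iUnion, mem_prod, mem_singleton_iff, mem_ofPred_eq, exists_prop]
    constructor
    · exact fun h => ⟨a, hEF _ h, rfl, h⟩
    · rintro ⟨c, -, rfl, h⟩; exact h
  have hE' : Prod.snd '' E = ⋃ c ∈ F, {v | (c, v) ∈ E} := by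
    ext v
    simp only [mem_iUnion, mem_image, mem_ofPred_eq, exists_prop]
    constructor
    · rintro ⟨⟨a, _⟩, h, rfl⟩; exact ⟨a, hEF _ h, h⟩
    · rintro ⟨c, -, h⟩; exact ⟨_, h, rfl⟩
  have hm : ∀ c, MeasurableSet ({c} ×ˢ {v | (c, v) ∈ E} : Set (ℝ × ℝ)) := fun c =>
    (measurableSet_singleton c).prod (hopen c).measurableSet
  refine ⟨?_, ?_⟩
  · rw [hE]; exact hF.measurableSet_biUnion fun c _ => hm c
  · rw [hE']
    nth_rw 1 [hE]
    rw [measure_biUnion hF.countable ?_ fun c _ => hm c,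
      measure_biUnion hF.countable ?_ fun c _ => (hopen c).measurableSet]
    · exact tsum_congr fun c => h₁ _ _ (hopen c).measurableSet
    · intro c _ c' _ hne
      exact Set.disjoint_left.2 fun v hv hv' => hne (hgraph _ _ _ hv hv')
    · intro c _ c' _ hne
      exact Set.disjoint_left.2 fun w hw hw' => hne (hw.1.symm.trans hw'.1)

theorem snd_image_ends {E : Set (ℝ × ℝ)}
    (hE : E = leftEnds P f g ∨ E = rightEnds P f g) :
    Prod.snd '' E = shadow P g f \ g '' P := by
  ext v
  constructor
  · rintro ⟨⟨a, v⟩, h, rfl⟩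
    rcases hE with rfl | rfl
    · exact ⟨mem_shadow_swap_iff.2 ⟨a, h.1⟩, h.2.1⟩
    · exact ⟨mem_shadow_swap_iff.2 ⟨a, h.1⟩, h.2.1⟩
  · rintro ⟨h, hv⟩
    have hne : {a | (a, v) ∈ orthoHull P f g}.Nonempty := mem_shadow_swap_iff.1 h
    rcases hE with rfl | rfl
    · obtain ⟨a, ha, hmin⟩ := (isCompact_row v).exists_isLeast hne
      exact ⟨(a, v), ⟨ha, hv, fun _ h => hmin h⟩, rfl⟩
    · obtain ⟨a, ha, hmax⟩ := (isCompact_row v).exists_isGreatest hne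
      exact ⟨(a, v), ⟨ha, hv, fun _ h => hmax h⟩, rfl⟩

theorem measure_ends (ν : Measure (ℝ × ℝ))
    (h₁ : ∀ (c : ℝ) (S : Set ℝ), MeasurableSet S → ν ({c} ×ˢ S) = volume S) {E : Set (ℝ × ℝ)}
    (hE : E = leftEnds P f g ∨ E = rightEnds P f g) :
    MeasurableSet E ∧ ν E = volume (shadow P g f) := by
  have hfin := P.finite_toSet.image g
  have := measure_graph ν h₁ (E := E) (P.finite_toSet.image f) ?_ (isOpen_rows_of_ends hE) ?_
  · refine ⟨this.1, this.2.trans ?_⟩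
    rw [snd_image_ends hE]
    exact measure_sdiff_null (hfin.measure_zero volume)
  · rcases hE with rfl | rfl
    · exact fun w hw => leftEnds_fst hw
    · exact fun w hw => rightEnds_fst hw
  · rcases hE with rfl | rfl
    · exact fun c c' v h h' => le_antisymm (h.2.2 _ h'.1) (h'.2.2 _ h.1)
    · exact fun c c' v h h' => le_antisymm (h'.2.2 _ h.1) (h.2.2 _ h'.1)

/-- The frontier is the union and the thin part is the intersection of the left and right ends, so
the sum of the measures is that of both families of ends, each a graph over the shadow. -/
theorem measure_boundary_rows (ν : Measure (ℝ × ℝ))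
    (h₁ : ∀ (c : ℝ) (S : Set ℝ), MeasurableSet S → ν ({c} ×ˢ S) = volume S) :
    ν (frontier (orthoHull P f g) ∩ {w | w.2 ∉ g '' P}) +
      ν ((orthoHull P f g \ closure (interior (orthoHull P f g))) ∩ {w | w.2 ∉ g '' P}) =
      2 * volume (shadow P g f) := by
  rw [frontier_inter_rows, thin_inter_rows,
    measure_union_add_inter _ (measure_ends ν h₁ (Or.inr rfl)).1,
    (measure_ends ν h₁ (Or.inl rfl)).2, (measure_ends ν h₁ (Or.inr rfl)).2, two_mul]

theorem orthoHull_swap : Prod.swap ⁻¹' orthoHull P f g = orthoHull P g f := by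
  ext ⟨a, b⟩
  exact swap_mem_orthoHull.symm

theorem measure_boundary_columns (ν : Measure (ℝ × ℝ))
    (h₂ : ∀ (c : ℝ) (S : Set ℝ), MeasurableSet S → ν (S ×ˢ {c}) = volume S) :
    ν (frontier (orthoHull P f g) ∩ {w | w.1 ∉ f '' P}) +
      ν ((orthoHull P f g \ closure (interior (orthoHull P f g))) ∩ {w | w.1 ∉ f '' P}) =
      2 * volume (shadow P f g) := by
  have hm : ∀ S : Set (ℝ × ℝ), ν.map Prod.swap S = ν (Prod.swap ⁻¹' S) := fun S =>
    (MeasurableEquiv.prodComm (α := ℝ) (β := ℝ)).map_apply S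
  have key := measure_boundary_rows (P := P) (f := g) (g := f) (ν.map Prod.swap) ?_
  · rw [hm, hm, preimage_inter, preimage_inter, preimage_sdiff] at key
    have e1 := (Homeomorph.prodComm ℝ ℝ).preimage_frontier (orthoHull P g f)
    have e2 := (Homeomorph.prodComm ℝ ℝ).preimage_closure (interior (orthoHull P g f))
    have e3 := (Homeomorph.prodComm ℝ ℝ).preimage_interior (orthoHull P g f)
    simp only [Homeomorph.coe_prodComm] at e1 e2 e3
    rw [e1, e2, e3, orthoHull_swap] at key
    exact key
  · intro c S hS
    rw [hm, ← h₂ c S hS, preimage_swap_prod]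

/-- The length of the boundary of the orthogonal hull, with the thin part counted twice, is twice
the sum of the lengths of its projections to the two axes. -/
theorem measure_boundary (ν : Measure (ℝ × ℝ))
    (h₁ : ∀ (c : ℝ) (S : Set ℝ), MeasurableSet S → ν ({c} ×ˢ S) = volume S)
    (h₂ : ∀ (c : ℝ) (S : Set ℝ), MeasurableSet S → ν (S ×ˢ {c}) = volume S) :
    ν (frontier (orthoHull P f g)) +
      ν (orthoHull P f g \ closure (interior (orthoHull P f g))) =
      2 * volume (shadow P f g) + 2 * volume (shadow P g f) := by
  have hsing : ∀ w : ℝ × ℝ, ν {w} = 0 := by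
    rintro ⟨a, b⟩
    rw [← singleton_prod_singleton, h₁ a {b} (measurableSet_singleton b)]
    simp
  have hgm : MeasurableSet {w : ℝ × ℝ | w.2 ∉ g '' P} :=
    ((P.finite_toSet.image g).measurableSet.preimage measurable_snd).compl
  -- A frontier point whose row avoids `P` lies on a column through `P`. Up to the finite grid of
  -- such rows and columns, the frontier is therefore the disjoint union of its parts off the rows
  -- and off the columns of `P`.
  have split : ∀ S ⊆ frontier (orthoHull P f g),
      ν S = ν (S ∩ {w | w.2 ∉ g '' P}) + ν (S ∩ {w | w.1 ∉ f '' P}) := by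
    intro S hS
    rw [← measure_inter_add_sdiff S hgm]
    congr 1
    have hsub : S ∩ {w | w.1 ∉ f '' P} ⊆ S \ {w | w.2 ∉ g '' P} := by
      rintro w ⟨hw, hwf⟩
      refine ⟨hw, fun hwg => hwf ?_⟩
      have : w ∈ leftEnds P f g ∪ rightEnds P f g := by
        rw [← frontier_inter_rows]; exact ⟨hS hw, hwg⟩
      exact this.elim leftEnds_fst rightEnds_fst
    refine le_antisymm ?_ (measure_mono hsub)
    have hfin : ((f '' P) ×ˢ (g '' P) : Set (ℝ × ℝ)).Finite :=
      (P.finite_toSet.image f).prod (P.finite_toSet.image g)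
    have h0 : ν ((f '' P) ×ˢ (g '' P)) = 0 := by
      rw [← biUnion_of_singleton ((f '' P) ×ˢ (g '' P))]
      exact (measure_biUnion_null_iff hfin.countable).2 fun w _ => hsing w
    calc ν (S \ {w | w.2 ∉ g '' P})
        ≤ ν ((S ∩ {w | w.1 ∉ f '' P}) ∪ (f '' P) ×ˢ (g '' P)) := by
          refine measure_mono fun w hw => ?_
          by_cases h : w.1 ∈ f '' P
          · exact Or.inr ⟨h, not_not.1 hw.2⟩
          · exact Or.inl ⟨hw.1, h⟩
      _ ≤ _ := measure_union_le _ _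
      _ = _ := by rw [h0, add_zero]
  rw [split _ subset_rfl, split (orthoHull P f g \ closure (interior (orthoHull P f g))) ?_,
    ← measure_boundary_columns ν h₂, ← measure_boundary_rows ν h₁]
  · ring
  · rw [isClosed_orthoHull.frontier_eq]
    exact sdiff_subset_sdiff_right subset_closure

end Planar

end OBeta

namespace OBeta

/-! ### Steps of staircases, overlaps and gaps -/

section Staircase

variable {α : Type*} (P : Finset α) (f g : α → ℝ)

/-- The points of `P` that are maximal for the product order in the coordinates `(f, g)`. -/
def IsVertex (p : α) : Prop := p ∈ P ∧ ∀ r ∈ P, ¬ (f p < f r ∧ g p < g r)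

/-- Consecutive vertices, the lower one first. -/
def IsStep (p q : α) : Prop :=
  IsVertex P f g p ∧ IsVertex P f g q ∧ g p < g q ∧
    ∀ r, IsVertex P f g r → ¬ (g p < g r ∧ g r < g q)

/-- The pairs of steps of two opposite staircases whose quadrants overlap. -/
def overlapSet : Set ((α × α) × (α × α)) :=
  {t | IsStep P f g t.1.1 t.1.2 ∧ IsStep P (-f) (-g) t.2.2 t.2.1 ∧ f t.1.2 < f t.2.1 ∧
    g t.1.1 < g t.2.2}

variable {P f g}

theorem IsStep.right_le {p q : α} (h : IsStep P f g p q) : f q ≤ f p :=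
  not_lt.1 fun hlt => h.1.2 q h.2.1.1 ⟨hlt, h.2.2.1⟩

/-- The highest point in the supposedly nonempty quadrant would be a vertex, and it would lie
strictly between `p` and `q`, equal `q`, or dominate `q`. -/
theorem IsStep.free (hg : InjOn g P) {p q : α} (h : IsStep P f g p q) {x : α} (hx : x ∈ P)
    (hfx : f q < f x) : g x ≤ g p := by
  by_contra! hgx
  have hne : (P.filter fun z => f q < f z ∧ g p < g z).Nonempty :=
    ⟨x, Finset.mem_filter.2 ⟨hx, hfx, hgx⟩⟩
  obtain ⟨z, hz, hmax⟩ := Finset.exists_max_image _ g hne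
  obtain ⟨hzP, hz1, hz2⟩ := Finset.mem_filter.1 hz
  have hzv : IsVertex P f g z := ⟨hzP, fun r hr hlt =>
    absurd (hmax r (Finset.mem_filter.2 ⟨hr, hz1.trans hlt.1, hz2.trans hlt.2⟩))
      (not_le.2 hlt.2)⟩
  rcases lt_trichotomy (g z) (g q) with h' | h' | h'
  · exact h.2.2.2 z hzv ⟨hz2, h'⟩
  · rw [hg hzP h.2.1.1 h'] at hz1; exact lt_irrefl _ hz1
  · exact h.2.1.2 z hzP ⟨hz1, h'⟩

theorem IsStep.right_unique (hg : InjOn g P) {p q q' : α} (h : IsStep P f g p q)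
    (h' : IsStep P f g p q') : q = q' := by
  refine hg h.2.1.1 h'.2.1.1 (le_antisymm ?_ ?_)
  · exact not_lt.1 fun hlt => h.2.2.2 q' h'.2.1 ⟨h'.2.2.1, hlt⟩
  · exact not_lt.1 fun hlt => h'.2.2.2 q h.2.1 ⟨h.2.2.1, hlt⟩

theorem injOn_neg (hg : InjOn g P) : InjOn (-g) P := fun _ hx _ hy h =>
  hg hx hy (neg_injective h)

theorem exists_step {a : ℝ} (h₁ : ∃ x ∈ P, a ≤ f x) (h₂ : ∃ y ∈ P, f y ≤ a)
    (hgap : ∀ x ∈ P, ∀ y ∈ P, a ≤ f x → f y ≤ a → g x < g y) :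
    ∃ p q, IsStep P f g p q ∧ f q < a ∧ a ≤ f p := by
  obtain ⟨x, hx, hxa⟩ := h₁
  obtain ⟨y, hy, hya⟩ := h₂
  obtain ⟨p, hp, hpmax⟩ := Finset.exists_max_image (P.filter fun z => a ≤ f z) g
    ⟨x, Finset.mem_filter.2 ⟨hx, hxa⟩⟩
  obtain ⟨hpP, hpa⟩ := Finset.mem_filter.1 hp
  have hlt : ∀ z ∈ P, g p < g z → f z < a := fun z hz h => not_le.1 fun h' =>
    absurd (hpmax z (Finset.mem_filter.2 ⟨hz, h'⟩)) (not_le.2 h)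
  obtain ⟨m, hm, hmmax⟩ := Finset.exists_max_image (P.filter fun z => g p < g z) f
    ⟨y, Finset.mem_filter.2 ⟨hy, hgap p hpP y hy hpa hya⟩⟩
  -- Several points may share the largest value of `f`; the lowest of them is the vertex consecutive
  -- to `p`.
  obtain ⟨q, hq, hqmin⟩ := Finset.exists_min_image (P.filter fun z => g p < g z ∧ f z = f m) g
    ⟨m, Finset.mem_filter.2 ⟨(Finset.mem_filter.1 hm).1, (Finset.mem_filter.1 hm).2, rfl⟩⟩
  obtain ⟨hqP, hpq, hqm⟩ := Finset.mem_filter.1 hq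
  refine ⟨p, q, ⟨⟨hpP, fun r hr h => ?_⟩, ⟨hqP, fun r hr h => ?_⟩, hpq, fun r hr h => ?_⟩,
    hlt q hqP hpq, hpa⟩
  · exact absurd (hlt r hr h.2) (not_lt.2 (hpa.trans h.1.le))
  · have := hmmax r (Finset.mem_filter.2 ⟨hr, hpq.trans h.2⟩)
    rw [← hqm] at this
    exact absurd this (not_le.2 h.1)
  · have h1 := hmmax r (Finset.mem_filter.2 ⟨hr.1, h.1⟩)
    rcases h1.lt_or_eq with h2 | h2
    · exact hr.2 q hqP ⟨h2.trans_eq hqm.symm, h.2⟩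
    · exact absurd (hqmin r (Finset.mem_filter.2 ⟨hr.1, h.1, h2⟩)) (not_le.2 h.2)

/-- If all points of `P` to the right of `a` are below all those to its left, then an overlapping
region contains points with first coordinate `a`. -/
theorem exists_overlap {a : ℝ} (h₁ : ∃ x ∈ P, a ≤ f x) (h₂ : ∃ y ∈ P, f y ≤ a)
    (hgap : ∀ x ∈ P, ∀ y ∈ P, a ≤ f x → f y ≤ a → g x < g y) :
    ∃ t ∈ overlapSet P f g, f t.1.2 < a ∧ a < f t.2.1 ∧ a ≤ f t.1.1 ∧ f t.2.2 ≤ a := by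
  obtain ⟨p, q, hpq, hqa, hpa⟩ := exists_step h₁ h₂ hgap
  obtain ⟨s, r, hsr, hra, hsa⟩ := exists_step (P := P) (f := -f) (g := -g) (a := -a)
    (by simpa using h₂) (by simpa using h₁) (by
      intro x hx y hy hx' hy'
      simp only [Pi.neg_apply, neg_le_neg_iff, neg_lt_neg_iff] at hx' hy' ⊢
      exact hgap y hy x hx hy' hx')
  simp only [Pi.neg_apply, neg_le_neg_iff, neg_lt_neg_iff] at hra hsa
  exact ⟨((p, q), (r, s)), ⟨hpq, hsr, hqa.trans hra,
    hgap p hpq.1.1 s hsr.1.1 hpa hsa⟩, hqa, hra, hpa, hsa⟩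

theorem overlap_above (hg : InjOn g P) {t : (α × α) × (α × α)} (ht : t ∈ overlapSet P f g)
    {x : α} (hx : x ∈ P) (h : f t.1.2 < f x) : g x ≤ g t.1.1 :=
  ht.1.free hg hx h

theorem overlap_below (hg : InjOn g P) {t : (α × α) × (α × α)} (ht : t ∈ overlapSet P f g)
    {x : α} (hx : x ∈ P) (h : f x < f t.2.1) : g t.2.2 ≤ g x := by
  have := ht.2.1.free (injOn_neg hg) hx (by simpa using h)
  simpa using this

theorem overlap_fst_ge (hg : InjOn g P) {t : (α × α) × (α × α)} (ht : t ∈ overlapSet P f g) :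
    f t.2.1 ≤ f t.1.1 :=
  not_lt.1 fun h => absurd (overlap_below hg ht ht.1.1.1 h) (not_le.2 ht.2.2.2)

theorem overlap_snd_le (hg : InjOn g P) {t : (α × α) × (α × α)} (ht : t ∈ overlapSet P f g) :
    f t.2.2 ≤ f t.1.2 :=
  not_lt.1 fun h => absurd (overlap_above hg ht ht.2.1.1.1 h) (not_le.2 ht.2.2.2)

/-- In an overlap, points beyond `f t.1.2` are no higher than `t.1.1`, points before `f t.2.1` are
no lower than `t.2.2`, and `t.1.1` is below `t.2.2`. So every column strictly inside separates `P`.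
The converse is `exists_overlap`. -/
theorem gap_iff (hg : InjOn g P) {a : ℝ} :
    ((∃ x ∈ P, a ≤ f x) ∧ (∃ y ∈ P, f y ≤ a) ∧
      ∀ x ∈ P, ∀ y ∈ P, a ≤ f x → f y ≤ a → g x < g y) ↔
      ∃ t ∈ overlapSet P f g, f t.1.2 < a ∧ a < f t.2.1 := by
  constructor
  · rintro ⟨h₁, h₂, h₃⟩
    obtain ⟨t, ht, h, h', -⟩ := exists_overlap h₁ h₂ h₃
    exact ⟨t, ht, h, h'⟩
  · rintro ⟨t, ht, h, h'⟩
    refine ⟨⟨t.2.1, ht.2.1.2.1.1, h'.le⟩, ⟨t.1.2, ht.1.2.1.1, h.le⟩, fun x hx y hy hx' hy' => ?_⟩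
    exact ((overlap_above hg ht hx (h.trans_le hx')).trans_lt ht.2.2.2).trans_le
      (overlap_below hg ht hy (hy'.trans_lt h'))

theorem gap_swap_iff (hg : InjOn g P) {b : ℝ} :
    ((∃ x ∈ P, b ≤ g x) ∧ (∃ y ∈ P, g y ≤ b) ∧
      ∀ x ∈ P, ∀ y ∈ P, b ≤ g x → g y ≤ b → f x < f y) ↔
      ∃ t ∈ overlapSet P f g, g t.1.1 < b ∧ b < g t.2.2 := by
  constructor
  · rintro ⟨⟨x, hx, hxb⟩, ⟨y, hy, hyb⟩, h⟩
    obtain ⟨x', hx', hmax⟩ := Finset.exists_max_image (P.filter fun z => b ≤ g z) f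
      ⟨x, Finset.mem_filter.2 ⟨hx, hxb⟩⟩
    obtain ⟨y', hy', hmin⟩ := Finset.exists_min_image (P.filter fun z => g z ≤ b) f
      ⟨y, Finset.mem_filter.2 ⟨hy, hyb⟩⟩
    rw [Finset.mem_filter] at hx' hy'
    obtain ⟨a, ha, ha'⟩ := exists_between (h x' hx'.1 y' hy'.1 hx'.2 hy'.2)
    have hup : ∀ z ∈ P, b ≤ g z → f z < a := fun z hz hb =>
      (hmax z (Finset.mem_filter.2 ⟨hz, hb⟩)).trans_lt ha
    have hlo : ∀ z ∈ P, g z ≤ b → a < f z := fun z hz hb =>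
      ha'.trans_le (hmin z (Finset.mem_filter.2 ⟨hz, hb⟩))
    have hup' : ∀ z ∈ P, a ≤ f z → g z < b := fun z hz hz' =>
      not_le.1 fun hb => absurd (hup z hz hb) (not_lt.2 hz')
    have hlo' : ∀ z ∈ P, f z ≤ a → b < g z := fun z hz hz' =>
      not_le.1 fun hb => absurd (hlo z hz hb) (not_lt.2 hz')
    -- The column `a` separates the points above `b` from those below `b`, hence is itself a gap.
    -- The overlap around it contains the height `b`, since `t.1.1` is right of `a` and `t.2.2` is
    -- left of it.
    obtain ⟨t, ht, -, -, h1, h2⟩ := exists_overlap (P := P) (f := f) (g := g) (a := a)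
      ⟨y', hy'.1, ha'.le⟩ ⟨x', hx'.1, ha.le⟩
      fun u hu v hv hu' hv' => (hup' u hu hu').trans (hlo' v hv hv')
    exact ⟨t, ht, hup' _ ht.1.1.1 h1, hlo' _ ht.2.1.1.1 h2⟩
  · rintro ⟨t, ht, h, h'⟩
    refine ⟨⟨t.2.2, ht.2.1.1.1, h'.le⟩, ⟨t.1.1, ht.1.1.1, h.le⟩, fun x hx y hy hx' hy' => ?_⟩
    have h1 : f x ≤ f t.1.2 := not_lt.1 fun hlt =>
      absurd (overlap_above hg ht hx hlt) (not_le.2 (h.trans_le hx'))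
    have h2 : f t.2.1 ≤ f y := not_lt.1 fun hlt =>
      absurd (overlap_below hg ht hy hlt) (not_le.2 (hy'.trans_lt h'))
    exact (h1.trans_lt ht.2.2.1).trans_le h2

/-- Both lower supports lie to the right of `a`, so each is at most as high as the other; the upper
supports are compared dually. The remaining two vertices are then determined as neighbours on their
staircases. This makes the widths of the overlaps disjoint, hence additive. -/
theorem overlap_unique (hg : InjOn g P) {t t' : (α × α) × (α × α)} (ht : t ∈ overlapSet P f g)
    (ht' : t' ∈ overlapSet P f g) {a : ℝ} (h₁ : f t.1.2 < a) (h₂ : a < f t.2.1)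
    (h₁' : f t'.1.2 < a) (h₂' : a < f t'.2.1) : t = t' := by
  obtain ⟨⟨p, q⟩, ⟨r, s⟩⟩ := t
  obtain ⟨⟨p', q'⟩, ⟨r', s'⟩⟩ := t'
  have hp : p = p' := by
    refine hg ht.1.1.1 ht'.1.1.1 (le_antisymm ?_ ?_)
    · exact overlap_above hg ht' ht.1.1.1 (h₁'.trans (h₂.trans_le (overlap_fst_ge hg ht)))
    · exact overlap_above hg ht ht'.1.1.1 (h₁.trans (h₂'.trans_le (overlap_fst_ge hg ht')))
  have hs : s = s' := by
    refine hg ht.2.1.1.1 ht'.2.1.1.1 (le_antisymm ?_ ?_)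
    · exact overlap_below hg ht ht'.2.1.1.1 ((overlap_snd_le hg ht').trans_lt (h₁'.trans h₂))
    · exact overlap_below hg ht' ht.2.1.1.1 ((overlap_snd_le hg ht).trans_lt (h₁.trans h₂'))
  subst hp hs
  have hq := ht.1.right_unique hg ht'.1
  have hr := ht.2.1.right_unique (injOn_neg hg) ht'.2.1
  simp only at hq hr
  subst hq hr
  rfl

theorem isVertex_congr {f' : α → ℝ} (h : ∀ x ∈ P, ∀ y ∈ P, (f x < f y ↔ f' x < f' y)) (p : α) :
    IsVertex P f g p ↔ IsVertex P f' g p :=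
  and_congr_right fun hp => forall₂_congr fun r hr => by rw [h p hp r hr]

theorem isStep_congr {f' : α → ℝ} (h : ∀ x ∈ P, ∀ y ∈ P, (f x < f y ↔ f' x < f' y)) (p q : α) :
    IsStep P f g p q ↔ IsStep P f' g p q := by
  simp only [IsStep, isVertex_congr (g := g) h]

theorem overlapSet_congr {f' : α → ℝ} (h : ∀ x ∈ P, ∀ y ∈ P, (f x < f y ↔ f' x < f' y)) :
    overlapSet P f g = overlapSet P f' g := by
  ext t
  have h' : ∀ x ∈ P, ∀ y ∈ P, ((-f) x < (-f) y ↔ (-f') x < (-f') y) := fun x hx y hy => by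
    simpa using h y hy x hx
  simp only [overlapSet, mem_ofPred_eq, isStep_congr (g := g) h, isStep_congr (g := -g) h']
  refine and_congr_right fun h1 => and_congr_right fun h2 => and_congr_left fun _ => ?_
  exact h _ h1.2.1.1 _ h2.2.1.1

theorem finite_overlapSet : (overlapSet P f g).Finite := by
  refine ((P.finite_toSet.prod P.finite_toSet).prod (P.finite_toSet.prod P.finite_toSet)).subset ?_
  exact fun t ht => ⟨⟨ht.1.1.1, ht.1.2.1.1⟩, ⟨ht.2.1.2.1.1, ht.2.1.1.1⟩⟩

end Staircase

/-! ### Lengths of the two shadows -/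

section Shadow

variable {α : Type*} {P : Finset α} {f g : α → ℝ}

theorem mem_shadow_iff_gaps {a : ℝ} : a ∈ shadow P f g ↔
    ((∃ x ∈ P, a ≤ f x) ∧ (∃ y ∈ P, f y ≤ a)) ∧
    (¬ ∀ x ∈ P, ∀ y ∈ P, a ≤ f x → f y ≤ a → g y < g x) ∧
    ¬ ∀ x ∈ P, ∀ y ∈ P, a ≤ f x → f y ≤ a → g x < g y := by
  push Not
  constructor
  · rintro ⟨⟨x, hx, y, hy, h1, h2, h3⟩, ⟨x', hx', y', hy', h1', h2', h3'⟩⟩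
    exact ⟨⟨⟨x, hx, h2⟩, y, hy, h1⟩, ⟨x, hx, y, hy, h2, h1, h3⟩,
      ⟨x', hx', y', hy', h2', h1', h3'⟩⟩
  · rintro ⟨-, ⟨x, hx, y, hy, h2, h1, h3⟩, ⟨x', hx', y', hy', h2', h1', h3'⟩⟩
    exact ⟨⟨x, hx, y, hy, h1, h2, h3⟩, ⟨x', hx', y', hy', h1', h2', h3'⟩⟩

theorem mem_shadow_iff_overlaps (hg : InjOn g P) {a : ℝ} : a ∈ shadow P f g ↔
    ((∃ x ∈ P, a ≤ f x) ∧ (∃ y ∈ P, f y ≤ a)) ∧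
    (¬ ∃ t ∈ overlapSet P (-f) g, f t.2.1 < a ∧ a < f t.1.2) ∧
    ¬ ∃ t ∈ overlapSet P f g, f t.1.2 < a ∧ a < f t.2.1 := by
  rw [mem_shadow_iff_gaps]
  refine and_congr_right fun hP => and_congr (not_congr ?_) (not_congr ?_)
  · have := gap_iff (P := P) (f := -f) hg (a := -a)
    simp only [Pi.neg_apply, neg_le_neg_iff, neg_lt_neg_iff] at this
    rw [exists_congr fun t => and_congr_right fun _ => and_comm, ← this]
    exact ⟨fun h => ⟨hP.2, hP.1, fun x hx y hy hx' hy' => h y hy x hx hy' hx'⟩,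
      fun h x hx y hy hx' hy' => h.2.2 y hy x hx hy' hx'⟩
  · rw [← gap_iff hg]
    exact ⟨fun h => ⟨hP.1, hP.2, h⟩, fun h => h.2.2⟩

theorem mem_shadow_swap_iff_overlaps (hg : InjOn g P) {b : ℝ} : b ∈ shadow P g f ↔
    ((∃ x ∈ P, b ≤ g x) ∧ (∃ y ∈ P, g y ≤ b)) ∧
    (¬ ∃ t ∈ overlapSet P (-f) g, g t.1.1 < b ∧ b < g t.2.2) ∧
    ¬ ∃ t ∈ overlapSet P f g, g t.1.1 < b ∧ b < g t.2.2 := by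
  rw [mem_shadow_iff_gaps]
  refine and_congr_right fun hP => and_congr (not_congr ?_) (not_congr ?_)
  · rw [← gap_swap_iff hg]
    simp only [Pi.neg_apply, neg_lt_neg_iff]
    exact ⟨fun h => ⟨hP.1, hP.2, h⟩, fun h => h.2.2⟩
  · rw [← gap_swap_iff hg]
    exact ⟨fun h => ⟨hP.1, hP.2, h⟩, fun h => h.2.2⟩

/-- The second projection of the hull depends on the first coordinates only through the
overlapping regions. -/
theorem shadow_swap_congr (hg : InjOn g P) {f' : α → ℝ}
    (h₁ : overlapSet P f g = overlapSet P f' g)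
    (h₂ : overlapSet P (-f) g = overlapSet P (-f') g) : shadow P g f = shadow P g f' := by
  ext b
  rw [mem_shadow_swap_iff_overlaps hg, mem_shadow_swap_iff_overlaps hg, h₁, h₂]

theorem volume_biUnion_Ioo {ι : Type*} (T : Finset ι) (l r : ι → ℝ) (hlr : ∀ t ∈ T, l t ≤ r t)
    (hd : (T : Set ι).PairwiseDisjoint fun t => Ioo (l t) (r t)) :
    volume (⋃ t ∈ T, Ioo (l t) (r t)) = ENNReal.ofReal (∑ t ∈ T, (r t - l t)) := by
  rw [measure_biUnion_finset hd fun _ _ => measurableSet_Ioo,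
    ENNReal.ofReal_sum_of_nonneg fun t ht => sub_nonneg.2 (hlr t ht)]
  simp

/-- The length of the first projection of the hull: the distance of the extreme points minus the
widths of all overlapping regions. -/
theorem volume_shadow (hg : InjOn g P) {p q : α} (hp : p ∈ P) (hq : q ∈ P)
    (hmin : ∀ x ∈ P, f p ≤ f x) (hmax : ∀ x ∈ P, f x ≤ f q) :
    volume (shadow P f g) ≠ ⊤ ∧ (volume (shadow P f g)).toReal = f q - f p -
      ∑ t ∈ (finite_overlapSet (P := P) (f := f) (g := g)).toFinset, (f t.2.1 - f t.1.2) -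
      ∑ t ∈ (finite_overlapSet (P := P) (f := -f) (g := g)).toFinset, (f t.1.2 - f t.2.1) := by
  set T₁ := (finite_overlapSet (P := P) (f := f) (g := g)).toFinset with hT₁
  set T₂ := (finite_overlapSet (P := P) (f := -f) (g := g)).toFinset with hT₂
  have m₁ : ∀ {t}, t ∈ T₁ ↔ t ∈ overlapSet P f g := fun {t} => Set.Finite.mem_toFinset _
  have m₂ : ∀ {t}, t ∈ T₂ ↔ t ∈ overlapSet P (-f) g := fun {t} => Set.Finite.mem_toFinset _
  set U₁ : Set ℝ := ⋃ t ∈ T₁, Ioo (f t.1.2) (f t.2.1) with hU₁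
  set U₂ : Set ℝ := ⋃ t ∈ T₂, Ioo (f t.2.1) (f t.1.2) with hU₂
  have mU₁ : ∀ a, a ∈ U₁ ↔ ∃ t ∈ overlapSet P f g, f t.1.2 < a ∧ a < f t.2.1 := by
    intro a; simp only [hU₁, mem_iUnion, m₁, mem_Ioo, exists_prop]
  have mU₂ : ∀ a, a ∈ U₂ ↔ ∃ t ∈ overlapSet P (-f) g, f t.2.1 < a ∧ a < f t.1.2 := by
    intro a; simp only [hU₂, mem_iUnion, m₂, mem_Ioo, exists_prop]
  have lt₂ : ∀ t ∈ overlapSet P (-f) g, f t.2.1 < f t.1.2 := fun t ht => by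
    simpa using ht.2.2.1
  have hIcc : ∀ a, a ∈ Icc (f p) (f q) ↔ (∃ x ∈ P, a ≤ f x) ∧ (∃ y ∈ P, f y ≤ a) := by
    intro a
    constructor
    · exact fun h => ⟨⟨q, hq, h.2⟩, ⟨p, hp, h.1⟩⟩
    · rintro ⟨⟨x, hx, h⟩, ⟨y, hy, h'⟩⟩
      exact ⟨(hmin y hy).trans h', h.trans (hmax x hx)⟩
  have hU₁s : U₁ ⊆ Icc (f p) (f q) := by
    intro a ha
    obtain ⟨t, ht, h, h'⟩ := (mU₁ a).1 ha
    exact (hIcc a).2 ⟨⟨_, ht.2.1.2.1.1, h'.le⟩, ⟨_, ht.1.2.1.1, h.le⟩⟩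
  have hU₂s : U₂ ⊆ Icc (f p) (f q) := by
    intro a ha
    obtain ⟨t, ht, h, h'⟩ := (mU₂ a).1 ha
    exact (hIcc a).2 ⟨⟨_, ht.1.2.1.1, h'.le⟩, ⟨_, ht.2.1.2.1.1, h.le⟩⟩
  -- On a common column, the points on one side would be both strictly higher and strictly lower
  -- than those on the other.
  have hdisj : Disjoint U₁ U₂ := by
    rw [Set.disjoint_left]
    intro a h₁ h₂
    obtain ⟨⟨x, hx, hxa⟩, ⟨y, hy, hya⟩, h⟩ := (gap_iff hg).2 ((mU₁ a).1 h₁)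
    obtain ⟨t, ht, h1, h2⟩ := (mU₂ a).1 h₂
    obtain ⟨-, -, h'⟩ := (gap_iff (f := -f) (a := -a) hg).2 ⟨t, ht, by simpa using ⟨h2, h1⟩⟩
    exact lt_asymm (h x hx y hy hxa hya)
      (h' y hy x hx (by simpa using hya) (by simpa using hxa))
  have hshadow : shadow P f g = Icc (f p) (f q) \ (U₁ ∪ U₂) := by
    ext a
    rw [mem_shadow_iff_overlaps hg, Set.mem_sdiff, hIcc, mem_union, not_or, mU₁, mU₂,
      and_comm (a := ¬ ∃ t ∈ overlapSet P (-f) g, _)]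
  have v₁ : volume U₁ = ENNReal.ofReal (∑ t ∈ T₁, (f t.2.1 - f t.1.2)) := by
    refine volume_biUnion_Ioo T₁ _ _ (fun t ht => (m₁.1 ht).2.2.1.le) ?_
    intro t ht t' ht' hne
    refine Set.disjoint_left.2 fun a h h' => hne ?_
    exact overlap_unique hg (m₁.1 ht) (m₁.1 ht') h.1 h.2 h'.1 h'.2
  have v₂ : volume U₂ = ENNReal.ofReal (∑ t ∈ T₂, (f t.1.2 - f t.2.1)) := by
    refine volume_biUnion_Ioo T₂ _ _ (fun t ht => (lt₂ t (m₂.1 ht)).le) ?_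
    intro t ht t' ht' hne
    refine Set.disjoint_left.2 fun a h h' => hne ?_
    exact overlap_unique (a := -a) hg (m₂.1 ht) (m₂.1 ht') (by simpa using h.2)
      (by simpa using h.1) (by simpa using h'.2) (by simpa using h'.1)
  have o₁ : IsOpen U₁ := isOpen_biUnion fun _ _ => isOpen_Ioo
  have o₂ : IsOpen U₂ := isOpen_biUnion fun _ _ => isOpen_Ioo
  have n₁ : 0 ≤ ∑ t ∈ T₁, (f t.2.1 - f t.1.2) :=
    Finset.sum_nonneg fun t ht => sub_nonneg.2 (m₁.1 ht).2.2.1.le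
  have n₂ : 0 ≤ ∑ t ∈ T₂, (f t.1.2 - f t.2.1) :=
    Finset.sum_nonneg fun t ht => sub_nonneg.2 (lt₂ t (m₂.1 ht)).le
  have vU : volume (U₁ ∪ U₂) = ENNReal.ofReal (∑ t ∈ T₁, (f t.2.1 - f t.1.2) +
      ∑ t ∈ T₂, (f t.1.2 - f t.2.1)) := by
    rw [measure_union hdisj o₂.measurableSet, v₁, v₂, ENNReal.ofReal_add n₁ n₂]
  have hv : volume (shadow P f g) = ENNReal.ofReal (f q - f p -
      (∑ t ∈ T₁, (f t.2.1 - f t.1.2) + ∑ t ∈ T₂, (f t.1.2 - f t.2.1))) := by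
    rw [hshadow, measure_sdiff (union_subset hU₁s hU₂s)
      (o₁.union o₂).measurableSet.nullMeasurableSet (by rw [vU]; exact ENNReal.ofReal_ne_top),
      Real.volume_Icc, vU, ENNReal.ofReal_sub _ (add_nonneg n₁ n₂)]
  refine ⟨by rw [hv]; exact ENNReal.ofReal_ne_top, ?_⟩
  rw [hv, ENNReal.toReal_ofReal]
  · ring
  · have hle : volume (U₁ ∪ U₂) ≤ volume (Icc (f p) (f q)) :=
      measure_mono (union_subset hU₁s hU₂s)
    rw [vU, Real.volume_Icc, ENNReal.ofReal_le_ofReal_iff (sub_nonneg.2 (hmin q hq))] at hle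
    linarith

theorem Icc_subset_shadow {x y x' y' : α} (hx : x ∈ P) (hy : y ∈ P) (hx' : x' ∈ P)
    (hy' : y' ∈ P) (h : f x ≤ f y) (h' : f y' ≤ f x') {b₁ b₂ : ℝ} (h₁ : g y ≤ b₁)
    (h₂ : b₂ ≤ g x) (h₁' : g y' ≤ b₁) (h₂' : b₂ ≤ g x') : Icc b₁ b₂ ⊆ shadow P g f :=
  fun _ hb => ⟨⟨x, hx, y, hy, h₁.trans hb.1, hb.2.trans h₂, h⟩,
    ⟨x', hx', y', hy', h₁'.trans hb.1, hb.2.trans h₂', h'⟩⟩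

/-- If the hull reaches beyond the points of `P` in the first coordinate, it does so in the second
one. -/
theorem exists_Icc_subset_shadow (hg : InjOn g P) {a : ℝ} (ha : a ∈ shadow P f g)
    (haP : a ∉ f '' P) : ∃ b₁ b₂, b₁ < b₂ ∧ Icc b₁ b₂ ⊆ shadow P g f := by
  obtain ⟨⟨x, hx, y, hy, h1, h2, h3⟩, ⟨x', hx', y', hy', h1', h2', h3'⟩⟩ := ha
  have ne : ∀ z ∈ P, f z ≠ a := fun z hz h => haP ⟨z, hz, h⟩
  have fy := lt_of_le_of_ne h1 (ne y hy)
  have fx := lt_of_le_of_ne h2 (ne x hx).symm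
  have fy' := lt_of_le_of_ne h1' (ne y' hy')
  have fx' := lt_of_le_of_ne h2' (ne x' hx').symm
  have gxy : g x < g y := lt_of_le_of_ne h3 fun h => by
    have := hg hx hy h; subst this; exact lt_asymm fx fy
  have gyx' : g y' < g x' := lt_of_le_of_ne h3' fun h => by
    have := hg hy' hx' h; subst this; exact lt_asymm fx' fy'
  have inj : ∀ z ∈ P, ∀ w ∈ P, g z ≤ g w → z = w ∨ g z < g w := fun z hz w hw h =>
    h.eq_or_lt.imp_left fun e => hg hz hw e
  -- Here the heights of `x` and `x'` lie within those of `y'` and `y`, and the rows between `x'`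
  -- and `x` work. If `x = x'`, rows from this point towards `y` or `y'` work, depending on which of
  -- these two is further right.
  by_cases hA : g x' ≤ g x
  · rcases inj x' hx' x hx hA with rfl | hlt
    · rcases le_total (f y') (f y) with h | h
      · exact ⟨_, _, gxy, Icc_subset_shadow hy hx hy hy' (fy.trans fx).le h le_rfl le_rfl
          gyx'.le le_rfl⟩
      · exact ⟨_, _, gyx', Icc_subset_shadow hy hy' hx hy' h (fy'.trans fx).le le_rfl gxy.le
          le_rfl le_rfl⟩
    · exact ⟨_, _, hlt, Icc_subset_shadow hy hx' hx hy' (fy.trans fx').le (fy'.trans fx).le le_rfl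
        gxy.le gyx'.le le_rfl⟩
  -- The same with the left and right points exchanged. In the last case the two ranges of heights
  -- overlap in an interval of positive length.
  by_cases hB : g y ≤ g y'
  · rcases inj y hy y' hy' hB with rfl | hlt
    · rcases le_total (f x) (f x') with h | h
      · exact ⟨_, _, gxy, Icc_subset_shadow hy hx hx' hx (fy.trans fx).le h le_rfl le_rfl
          le_rfl gyx'.le⟩
      · exact ⟨_, _, gyx', Icc_subset_shadow hx' hx hx' hy h (fy.trans fx').le gxy.le le_rfl
          le_rfl le_rfl⟩
    · exact ⟨_, _, hlt, Icc_subset_shadow hy' hx hx' hy (fy'.trans fx).le (fy.trans fx').le gxy.le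
        le_rfl le_rfl gyx'.le⟩
  push Not at hA hB
  exact ⟨max (g x) (g y'), min (g y) (g x'), max_lt (lt_min gxy hA) (lt_min hB gyx'),
    Icc_subset_shadow hy hx hx' hy' (fy.trans fx).le (fy'.trans fx').le (le_max_left _ _)
      (min_le_left _ _) (le_max_right _ _) (min_le_right _ _)⟩

theorem volume_shadow_eq_zero (hg : InjOn g P) (h : volume (shadow P g f) = 0) :
    volume (shadow P f g) = 0 := by
  refine measure_mono_null (fun a ha => ?_) ((P.finite_toSet.image f).measure_zero volume)
  by_contra haP
  obtain ⟨b₁, b₂, hlt, hsub⟩ := exists_Icc_subset_shadow hg ha haP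
  have := measure_mono_null hsub h
  rw [Real.volume_Icc, ENNReal.ofReal_eq_zero] at this
  linarith

theorem volume_shadow_eq_zero_of_antitone
    (h : ∀ x ∈ P, ∀ y ∈ P, g x ≤ g y → x = y ∨ f y < f x) : volume (shadow P f g) = 0 := by
  refine measure_mono_null (fun a ha => ?_) ((P.finite_toSet.image f).measure_zero volume)
  obtain ⟨-, ⟨x, hx, y, hy, h1, h2, h3⟩⟩ := ha
  rcases h y hy x hx h3 with rfl | h'
  · exact ⟨y, hy, le_antisymm h1 h2⟩
  · exact absurd (h1.trans h2) (not_le.2 h')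

theorem shadow_neg_right : shadow P g (-f) = shadow P g f := by
  ext a
  simp only [shadow, mem_ofPred_eq, Pi.neg_apply, neg_le_neg_iff, and_comm]

theorem shadow_smul_right {c : ℝ} (hc : 0 < c) : shadow P f (fun x => g x * c) = shadow P f g := by
  ext a
  simp only [shadow, mem_ofPred_eq, mul_le_mul_iff_left₀ hc]

theorem shadow_smul_left {c : ℝ} (hc : 0 < c) :
    shadow P (fun x => g x * c) f = (fun b => b * c⁻¹) ⁻¹' shadow P g f := by
  ext a
  simp only [shadow, mem_ofPred_eq, mem_preimage, ← div_eq_mul_inv, le_div_iff₀ hc,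
    div_le_iff₀ hc]

theorem volume_shadow_smul {c : ℝ} (hc : 0 < c) :
    volume (shadow P (fun x => g x * c) f) = ENNReal.ofReal c * volume (shadow P g f) := by
  rw [shadow_smul_left hc, Real.volume_preimage_mul_right (inv_ne_zero hc.ne'), inv_inv,
    abs_of_pos hc]

end Shadow

end OBeta

namespace OBeta

/-! ### From the slanted hull to the orthogonal one -/

section Hull

variable {P : Finset Plane} {β : ℝ}

/-- Arc length along the slanted lines. -/
noncomputable def slantY (β : ℝ) (w : Plane) : ℝ := w 1 * (Real.sin β)⁻¹

/-- The coordinates along the axes with slopes `0` and `tan β`. -/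
noncomputable def slantHomeomorph (β : ℝ) (hβ : 0 < Real.sin β) : Plane ≃ₜ ℝ × ℝ where
  toFun w := (slantX β w, slantY β w)
  invFun z := !₂[z.1 + z.2 * Real.cos β, z.2 * Real.sin β]
  left_inv w := by
    ext i
    fin_cases i
    · simp [slantX, slantY, Real.cot_eq_cos_div_sin]; field_simp; ring
    · simp [slantY, hβ.ne']
  right_inv z := by
    ext
    · simp [slantX, Real.cot_eq_cos_div_sin]; field_simp; ring
    · simp [slantY, hβ.ne']
  continuous_toFun := by unfold slantX slantY; fun_prop
  continuous_invFun := by fun_prop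

theorem slantHomeomorph_apply (hβ : 0 < Real.sin β) (w : Plane) :
    slantHomeomorph β hβ w = (slantX β w, slantY β w) := rfl

theorem slantHomeomorph_symm_apply (hβ : 0 < Real.sin β) (z : ℝ × ℝ) :
    (slantHomeomorph β hβ).symm z = !₂[z.1 + z.2 * Real.cos β, z.2 * Real.sin β] := rfl

/-- If the closed quadrant at `w` misses the finite set `P`, its apex can be moved back by a small
`ε` without meeting `P`, and the resulting open free quadrant contains `w`. -/
theorem mem_hull_iff (hβ : 0 < Real.sin β) {w : Plane} : w ∈ hull P β ↔
    ∀ X : Corner, ∃ p ∈ P, X.hSign * slantX β w ≤ X.hSign * slantX β p ∧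
      X.vSign * w 1 ≤ X.vSign * p 1 := by
  constructor
  · intro hw X
    by_contra! hcon
    have hh : X.hSign * X.hSign = 1 := by cases X <;> norm_num [Corner.hSign]
    have hv : X.vSign * X.vSign = 1 := by cases X <;> norm_num [Corner.vSign]
    have hev : ∀ᶠ ε in 𝓝[>] (0 : ℝ), ∀ p ∈ P, X.hSign * slantX β p < X.hSign * slantX β w - ε ∨
        X.vSign * p 1 < X.vSign * w 1 - ε := by
      rw [Filter.eventually_all_finset]
      intro p hp
      refine Filter.Eventually.filter_mono nhdsWithin_le_nhds ?_
      by_cases h : X.hSign * slantX β w ≤ X.hSign * slantX β p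
      · filter_upwards [eventually_lt_nhds (sub_pos.2 (hcon p hp h))] with ε hε
        right; linarith
      · push Not at h
        filter_upwards [eventually_lt_nhds (sub_pos.2 h)] with ε hε
        left; linarith
    obtain ⟨ε, hε, hpos⟩ := (hev.and self_mem_nhdsWithin).exists
    have hpos : 0 < ε := hpos
    set z : Plane := (slantHomeomorph β hβ).symm
      (slantX β w - X.hSign * ε, slantY β w - X.vSign * ε * (Real.sin β)⁻¹) with hz
    have hzz := (slantHomeomorph β hβ).apply_symm_apply
      (slantX β w - X.hSign * ε, slantY β w - X.vSign * ε * (Real.sin β)⁻¹)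
    rw [← hz, slantHomeomorph_apply, Prod.mk.injEq] at hzz
    have hz0 := hzz.1
    have hz1 : z 1 = w 1 - X.vSign * ε := by
      have := hzz.2
      simp only [slantY, ← sub_mul] at this
      exact mul_right_cancel₀ (inv_ne_zero hβ.ne') this
    refine hw (mem_sUnion.2 ⟨quadrant β X z, ⟨⟨X, z, rfl⟩, fun p hp hpq => ?_⟩, ?_⟩)
    · obtain ⟨h1, h2⟩ := hpq
      rw [hz0] at h1
      rw [hz1] at h2
      have e1 : X.hSign * (slantX β p - (slantX β w - X.hSign * ε)) =
        X.hSign * slantX β p - X.hSign * slantX β w + (X.hSign * X.hSign) * ε := by ring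
      have e2 : X.vSign * (p 1 - (w 1 - X.vSign * ε)) =
        X.vSign * p 1 - X.vSign * w 1 + (X.vSign * X.vSign) * ε := by ring
      rw [e1, hh] at h1
      rw [e2, hv] at h2
      rcases hε p hp with h | h <;> linarith
    · refine ⟨?_, ?_⟩
      · rw [hz0, sub_sub_cancel, ← mul_assoc, hh, one_mul]; exact hpos
      · rw [hz1, sub_sub_cancel, ← mul_assoc, hv, one_mul]; exact hpos
  · rintro h ⟨q, ⟨⟨X, z, rfl⟩, hfree⟩, hwq⟩
    obtain ⟨p, hp, h1, h2⟩ := h X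
    refine hfree p hp ⟨?_, ?_⟩
    · have := hwq.1; rw [mul_sub] at this ⊢; linarith
    · have := hwq.2; rw [mul_sub] at this ⊢; linarith

theorem hull_eq_preimage (hβ : 0 < Real.sin β) :
    hull P β = slantHomeomorph β hβ ⁻¹' orthoHull P (slantX β) (slantY β) := by
  have hi : 0 < (Real.sin β)⁻¹ := inv_pos.2 hβ
  ext w
  simp only [mem_hull_iff hβ, mem_preimage, slantHomeomorph_apply, orthoHull, mem_ofPred_eq,
    slantY, mul_le_mul_iff_left₀ hi]
  constructor
  · intro h
    have h1 := h .bottomLeft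
    have h2 := h .topLeft
    have h3 := h .bottomRight
    have h4 := h .topRight
    simp only [Corner.hSign, Corner.vSign, one_mul, neg_mul, neg_le_neg_iff] at h1 h2 h3 h4
    exact ⟨h1, h2, h3, h4⟩
  · rintro ⟨h1, h2, h3, h4⟩ X
    cases X <;> simpa only [Corner.hSign, Corner.vSign, one_mul, neg_mul, neg_le_neg_iff]

theorem isometry_slanted (β c : ℝ) :
    Isometry fun s : ℝ => (!₂[c + s * Real.cos β, s * Real.sin β] : Plane) := by
  refine Isometry.of_dist_eq fun s t => ?_
  rw [EuclideanSpace.dist_eq, Real.dist_eq, ← Real.sqrt_sq_eq_abs]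
  congr 1
  simp only [Fin.sum_univ_two, Real.dist_eq, sq_abs]
  simp
  linear_combination (s - t) ^ 2 * Real.sin_sq_add_cos_sq β

theorem isometry_horizontal (c d : ℝ) :
    Isometry fun u : ℝ => (!₂[u + d, c] : Plane) := by
  refine Isometry.of_dist_eq fun s t => ?_
  rw [EuclideanSpace.dist_eq, Real.dist_eq, ← Real.sqrt_sq_eq_abs]
  congr 1
  simp only [Fin.sum_univ_two, Real.dist_eq, sq_abs]
  simp

/-- The oblique coordinates are not isometric, but they preserve length along each of the two axis
directions. That is all `measure_boundary` asks of the transported Hausdorff measure. -/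
theorem boundaryLength_eq (hβ : 0 < Real.sin β) : boundaryLength P β =
    2 * volume (shadow P (slantX β) (slantY β)) + 2 * volume (shadow P (slantY β) (slantX β)) := by
  set T := slantHomeomorph β hβ with hT
  have hm : ∀ S : Set (ℝ × ℝ), (Measure.hausdorffMeasure 1 : Measure Plane).map T S =
      Measure.hausdorffMeasure 1 (T ⁻¹' S) := fun S => T.toMeasurableEquiv.map_apply S
  rw [boundaryLength, thinPart, hull_eq_preimage hβ, ← hT, ← T.preimage_frontier,
    ← T.preimage_interior, ← T.preimage_closure, ← preimage_sdiff, ← hm, ← hm]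
  refine measure_boundary _ ?_ ?_
  · intro c S _
    rw [hm, ← T.image_symm, singleton_prod, image_image]
    simp only [hT, slantHomeomorph_symm_apply]
    rw [(isometry_slanted β c).hausdorffMeasure_image (Or.inl zero_le_one), hausdorffMeasure_real]
  · intro c S _
    rw [hm, ← T.image_symm, prod_singleton, image_image]
    simp only [hT, slantHomeomorph_symm_apply]
    rw [(isometry_horizontal _ _).hausdorffMeasure_image (Or.inl zero_le_one),
      hausdorffMeasure_real]

/-- The height of a point. -/
def height (w : Plane) : ℝ := w 1

theorem slantY_eq : slantY β = fun w => height w * (Real.sin β)⁻¹ := rfl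

theorem boundaryLength_eq_height (hβ : 0 < Real.sin β) : boundaryLength P β =
    2 * volume (shadow P (slantX β) height) +
      2 * (ENNReal.ofReal (Real.sin β)⁻¹ * volume (shadow P height (slantX β))) := by
  rw [boundaryLength_eq hβ, slantY_eq, shadow_smul_right (inv_pos.2 hβ),
    volume_shadow_smul (inv_pos.2 hβ)]

theorem vertices_topRight : vertices P β .topRight = {p | IsVertex P (slantX β) height p} := by
  ext p
  simp [vertices, IsVertex, quadrant, Corner.hSign, Corner.vSign, height]

theorem vertices_topLeft : vertices P β .topLeft = {p | IsVertex P (-slantX β) height p} := by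
  ext p
  simp [vertices, IsVertex, quadrant, Corner.hSign, Corner.vSign, height]

theorem vertices_bottomRight :
    vertices P β .bottomRight = {p | IsVertex P (slantX β) (-height) p} := by
  ext p
  simp [vertices, IsVertex, quadrant, Corner.hSign, Corner.vSign, height]

theorem vertices_bottomLeft :
    vertices P β .bottomLeft = {p | IsVertex P (-slantX β) (-height) p} := by
  ext p
  simp [vertices, IsVertex, quadrant, Corner.hSign, Corner.vSign, height]

theorem consecutive_iff_of_top {X : Corner} {f : Plane → ℝ}
    (h : vertices P β X = {p | IsVertex P f height p}) {p q : Plane} :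
    Consecutive P β X p q ↔ IsStep P f height p q := by
  simp only [Consecutive, IsStep, h, mem_ofPred_eq, height]

theorem consecutive_iff_of_bottom {X : Corner} {f : Plane → ℝ}
    (h : vertices P β X = {p | IsVertex P f (-height) p}) {p q : Plane} :
    Consecutive P β X p q ↔ IsStep P f (-height) q p := by
  simp only [Consecutive, IsStep, h, mem_ofPred_eq, height, Pi.neg_apply, neg_lt_neg_iff]
  constructor
  · exact fun ⟨h1, h2, h3, h4⟩ => ⟨h2, h1, h3, fun r hr h => h4 r hr h.symm⟩
  · exact fun ⟨h1, h2, h3, h4⟩ => ⟨h2, h1, h3, fun r hr h => h4 r hr h.symm⟩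

/-- In oblique coordinates the intersection is a product of two open intervals, so it is enough that
both are nonempty. -/
theorem supported_inter_nonempty (hβ : 0 < Real.sin β) (X : Corner) (p q r s : Plane) :
    (supportedQuadrant β X p q ∩ supportedQuadrant β X.opposite r s).Nonempty ↔
      min (X.hSign * slantX β p) (X.hSign * slantX β q) <
        max (X.hSign * slantX β r) (X.hSign * slantX β s) ∧
      min (X.vSign * p 1) (X.vSign * q 1) < max (X.vSign * r 1) (X.vSign * s 1) := by
  have eh : X.opposite.hSign = -X.hSign := by cases X <;> simp [Corner.opposite, Corner.hSign]
  have ev : X.opposite.vSign = -X.vSign := by cases X <;> simp [Corner.opposite, Corner.vSign]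
  have hh : X.hSign * X.hSign = 1 := by cases X <;> norm_num [Corner.hSign]
  have hv : X.vSign * X.vSign = 1 := by cases X <;> norm_num [Corner.vSign]
  simp only [supportedQuadrant, eh, ev, neg_mul, min_neg_neg, neg_lt_neg_iff]
  constructor
  · rintro ⟨w, ⟨h1, h2⟩, ⟨h3, h4⟩⟩
    exact ⟨h1.trans h3, h2.trans h4⟩
  · rintro ⟨h1, h2⟩
    obtain ⟨u, hu1, hu2⟩ := exists_between h1
    obtain ⟨v, hv1, hv2⟩ := exists_between h2
    have hzz := (slantHomeomorph β hβ).apply_symm_apply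
      (X.hSign * u, X.vSign * v * (Real.sin β)⁻¹)
    set z := (slantHomeomorph β hβ).symm (X.hSign * u, X.vSign * v * (Real.sin β)⁻¹)
    rw [slantHomeomorph_apply, Prod.mk.injEq] at hzz
    have hz1 : z 1 = X.vSign * v := mul_right_cancel₀ (inv_ne_zero hβ.ne') hzz.2
    refine ⟨z, ?_⟩
    simp only [mem_inter_iff, mem_ofPred_eq, hzz.1, hz1, ← mul_assoc, hh, hv, one_mul]
    exact ⟨⟨hu1, hv1⟩, ⟨hu2, hv2⟩⟩

theorem overlaps_topRight (hβ : 0 < Real.sin β) :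
    overlaps P β .topRight = overlapSet P (slantX β) height := by
  ext t
  simp only [overlaps, overlapSet, mem_ofPred_eq, supported_inter_nonempty hβ]
  rw [consecutive_iff_of_top vertices_topRight, Corner.opposite,
    consecutive_iff_of_bottom vertices_bottomLeft]
  refine and_congr_right fun h1 => and_congr_right fun h2 => ?_
  have e1 := h1.right_le
  have e2 := h2.right_le
  have e3 := h1.2.2.1
  have e4 := h2.2.2.1
  simp only [Pi.neg_apply, neg_le_neg_iff, neg_lt_neg_iff] at e2 e4
  simp only [height] at e3 e4 ⊢
  simp only [Corner.hSign, Corner.vSign, one_mul, min_eq_right e1, min_eq_left e3.le,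
    max_eq_left e2, max_eq_right e4.le]

theorem overlaps_topLeft (hβ : 0 < Real.sin β) :
    overlaps P β .topLeft = overlapSet P (-slantX β) height := by
  ext t
  simp only [overlaps, overlapSet, mem_ofPred_eq, supported_inter_nonempty hβ]
  rw [consecutive_iff_of_top vertices_topLeft, Corner.opposite, neg_neg,
    consecutive_iff_of_bottom vertices_bottomRight]
  refine and_congr_right fun h1 => and_congr_right fun h2 => ?_
  have e1 := h1.right_le
  have e2 := h2.right_le
  have e3 := h1.2.2.1
  have e4 := h2.2.2.1
  simp only [Pi.neg_apply, neg_le_neg_iff, neg_lt_neg_iff] at e1 e4 ⊢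
  simp only [height] at e3 e4 ⊢
  simp only [Corner.hSign, Corner.vSign, one_mul, neg_mul, min_eq_right (neg_le_neg e1),
    min_eq_left e3.le, max_eq_left (neg_le_neg e2), max_eq_right e4.le, neg_lt_neg_iff]

end Hull

end OBeta

namespace OBeta

/-! ### Upper semicontinuity, extreme points and local constancy -/

section Semicontinuity

variable {α : Type*} {P : Finset α}

theorem eventually_not_mem_half_shadow {F G : ℝ → α → ℝ} {β₀ a : ℝ}
    (hF : ∀ x, ContinuousAt (fun β => F β x) β₀) (hG : ∀ x, ContinuousAt (fun β => G β x) β₀)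
    (h : ¬ ∃ x ∈ P, ∃ y ∈ P, F β₀ y ≤ a ∧ a ≤ F β₀ x ∧ G β₀ x ≤ G β₀ y) :
    ∀ᶠ z : ℝ × ℝ in 𝓝 β₀ ×ˢ 𝓝 a,
      ¬ ∃ x ∈ P, ∃ y ∈ P, F z.1 y ≤ z.2 ∧ z.2 ≤ F z.1 x ∧ G z.1 x ≤ G z.1 y := by
  have tF : ∀ x, Tendsto (fun z : ℝ × ℝ => F z.1 x) (𝓝 β₀ ×ˢ 𝓝 a) (𝓝 (F β₀ x)) := fun x =>
    (hF x).tendsto.comp tendsto_fst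
  have tG : ∀ x, Tendsto (fun z : ℝ × ℝ => G z.1 x) (𝓝 β₀ ×ˢ 𝓝 a) (𝓝 (G β₀ x)) := fun x =>
    (hG x).tendsto.comp tendsto_fst
  have ta : Tendsto (fun z : ℝ × ℝ => z.2) (𝓝 β₀ ×ˢ 𝓝 a) (𝓝 a) := tendsto_snd
  push Not at h ⊢
  rw [Filter.eventually_all_finset]
  intro x hx
  rw [Filter.eventually_all_finset]
  intro y hy
  rcases lt_or_ge a (F β₀ y) with h1 | h1
  · filter_upwards [ta.eventually_lt (tF y) h1] with z hz h'
    exact absurd h' (not_le.2 hz)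
  rcases lt_or_ge (F β₀ x) a with h2 | h2
  · filter_upwards [(tF x).eventually_lt ta h2] with z hz _ h'
    exact absurd h' (not_le.2 hz)
  filter_upwards [(tG y).eventually_lt (tG x) (h x hx y hy h1 h2)] with z hz _ _
  exact hz

/-- Shadows are cut out by closed conditions jointly in the parameter and the point. By compactness
of `Icc (-R) R`, nearby shadows stay inside any open set that contains the shadow at `β₀`, and such
a set can be chosen with measure below `y`. -/
theorem upperSemicontinuousAt_volume_shadow {F G : ℝ → α → ℝ} {β₀ : ℝ}
    (hF : ∀ x, ContinuousAt (fun β => F β x) β₀) (hG : ∀ x, ContinuousAt (fun β => G β x) β₀) :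
    UpperSemicontinuousAt (fun β => volume (shadow P (F β) (G β))) β₀ := by
  intro y hy
  obtain ⟨O, hO, hOo, hOy⟩ := Set.exists_isOpen_lt_of_lt _ _ hy
  set R : ℝ := ∑ x ∈ P, |F β₀ x| + 1 with hR
  have hbound : ∀ᶠ β in 𝓝 β₀, ∀ x ∈ P, |F β x| < R := by
    rw [Filter.eventually_all_finset]
    intro x hx
    refine (hF x).abs.eventually_lt continuousAt_const ?_
    have := Finset.single_le_sum (f := fun x => |F β₀ x|) (fun i _ => abs_nonneg _) hx
    linarith
  have hsub : ∀ᶠ β in 𝓝 β₀, ∀ a ∈ Icc (-R) R, a ∈ shadow P (F β) (G β) → a ∈ O := by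
    refine isCompact_Icc.eventually_forall_of_forall_eventually fun a _ => ?_
    rw [nhds_prod_eq]
    by_cases ha : a ∈ O
    · filter_upwards [(tendsto_snd (f := 𝓝 β₀)).eventually (hOo.mem_nhds ha)] with z hz _ using hz
    · have hn : a ∉ shadow P (F β₀) (G β₀) := fun h => ha (hO h)
      simp only [shadow, mem_ofPred_eq, not_and_or] at hn
      rcases hn with hn | hn
      · filter_upwards [eventually_not_mem_half_shadow hF hG hn] with z hz h
        exact absurd h.1 hz
      · have := eventually_not_mem_half_shadow (P := P) (G := fun β x => -G β x) hF
          (fun x => (hG x).neg) (by simpa only [neg_le_neg_iff] using hn)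
        filter_upwards [this] with z hz h
        simp only [neg_le_neg_iff] at hz
        exact absurd h.2 hz
  filter_upwards [hbound, hsub] with β h1 h2
  refine (measure_mono fun a ha => h2 a ?_ ha).trans_lt hOy
  obtain ⟨⟨x, hx, y, hy, h3, h4, -⟩, -⟩ := ha
  exact ⟨(abs_lt.1 (h1 y hy)).1.le.trans h3, h4.trans (abs_lt.1 (h1 x hx)).2.le⟩

/-- This recovers the extreme points from the staircases, so that the absence of vertex events keeps
them extreme. -/
theorem isVertex_both_iff {f g : α → ℝ} (hg : InjOn g P) {p : α} :
    IsVertex P f g p ∧ IsVertex P f (-g) p ↔ p ∈ P ∧ ∀ x ∈ P, f x ≤ f p := by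
  constructor
  · rintro ⟨h1, h2⟩
    refine ⟨h1.1, fun x hx => not_lt.1 fun hlt => ?_⟩
    rcases lt_trichotomy (g p) (g x) with h | h | h
    · exact h1.2 x hx ⟨hlt, h⟩
    · rw [hg h1.1 hx h] at hlt; exact lt_irrefl _ hlt
    · exact h2.2 x hx ⟨hlt, neg_lt_neg h⟩
  · rintro ⟨hp, h⟩
    exact ⟨⟨hp, fun r hr h' => not_lt.2 (h r hr) h'.1⟩, ⟨hp, fun r hr h' => not_lt.2 (h r hr) h'.1⟩⟩

theorem volume_shadow_ne_top (f g : α → ℝ) : volume (shadow P f g) ≠ ⊤ := by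
  obtain ⟨m, hm⟩ := (P.finite_toSet.image f).bddBelow
  obtain ⟨M, hM⟩ := (P.finite_toSet.image f).bddAbove
  refine ((measure_mono ?_).trans_lt (measure_Icc_lt_top (a := m) (b := M))).ne
  rintro a ⟨⟨x, hx, y, hy, h1, h2, -⟩, -⟩
  exact ⟨(hm ⟨y, hy, rfl⟩).trans h1, h2.trans (hM ⟨x, hx, rfl⟩)⟩

theorem eq_of_locally_eq {ι : Type*} {F : ℝ → ι} {a b : ℝ}
    (h : ∀ β ∈ Ioo a b, ∀ᶠ γ in 𝓝 β, F γ = F β) {β γ : ℝ} (hβ : β ∈ Ioo a b)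
    (hγ : γ ∈ Ioo a b) : F β = F γ := by
  have hc : IsLocallyConstant fun x : Ioo a b => F x := by
    rw [IsLocallyConstant.iff_eventually_eq]
    exact fun x => continuous_subtype_val.continuousAt.eventually (h x x.2)
  have : PreconnectedSpace (Ioo a b) := Subtype.preconnectedSpace isPreconnected_Ioo
  exact hc.apply_eq_of_preconnectedSpace ⟨β, hβ⟩ ⟨γ, hγ⟩

end Semicontinuity

/-! ### Cotangent and the shape of the perimeter formula -/

section Angles

open Real

theorem sin_pos_of_mem {β : ℝ} (hβ : β ∈ Ioo 0 π) : 0 < sin β := sin_pos_of_mem_Ioo hβ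

theorem cot_injOn : InjOn cot (Ioo 0 π) := by
  intro β hβ γ hγ h
  have h1 := sin_pos_of_mem hβ
  have h2 := sin_pos_of_mem hγ
  rw [cot_eq_cos_div_sin, cot_eq_cos_div_sin, div_eq_div_iff h1.ne' h2.ne'] at h
  have h3 : sin (γ - β) = 0 := by rw [sin_sub]; linarith
  have := (sin_eq_zero_iff_of_lt_of_lt (by linarith [hβ.2, hγ.1]) (by linarith [hβ.1, hγ.2])).1 h3
  linarith

theorem continuousAt_cot {β : ℝ} (hβ : β ∈ Ioo 0 π) : ContinuousAt cot β := by
  have : cot = fun x => cos x / sin x := funext cot_eq_cos_div_sin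
  rw [this]
  exact continuous_cos.continuousAt.div continuous_sin.continuousAt (sin_pos_of_mem hβ).ne'

/-- The inverse of the cotangent on `(0, π)`. -/
noncomputable def arccot (c : ℝ) : ℝ := π / 2 - arctan c

theorem continuous_arccot : Continuous arccot := continuous_const.sub continuous_arctan

theorem arccot_mem (c : ℝ) : arccot c ∈ Ioo 0 π := by
  have h1 := neg_pi_div_two_lt_arctan c
  have h2 := arctan_lt_pi_div_two c
  constructor <;> simp only [arccot] <;> linarith

theorem cot_arccot (c : ℝ) : cot (arccot c) = c := by
  rw [cot_eq_cos_div_sin, arccot, cos_pi_div_two_sub, sin_pi_div_two_sub, ← tan_eq_sin_div_cos,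
    tan_arctan]

theorem arccot_cot {β : ℝ} (hβ : β ∈ Ioo 0 π) : arccot (cot β) = β :=
  cot_injOn (arccot_mem _) hβ (cot_arccot _)

theorem hasDerivAt_perimeter_formula (A B C : ℝ) {β : ℝ} (hβ : β ∈ Ioo 0 π) :
    HasDerivAt (fun x => A * cot x + B * (sin x)⁻¹ + C) (-(A + B * cos β) / sin β ^ 2) β := by
  have hs := (sin_pos_of_mem hβ).ne'
  have e : (fun x => A * cot x + B * (sin x)⁻¹ + C) =
      fun x => A * (cos x / sin x) + B * (sin x)⁻¹ + C := by
    funext x; rw [cot_eq_cos_div_sin]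
  rw [e]
  have h1 := ((hasDerivAt_cos β).div (hasDerivAt_sin β) hs).const_mul A
  have h2 := ((hasDerivAt_sin β).inv hs).const_mul B
  refine ((h1.add h2).add_const C).congr_deriv ?_
  field_simp
  linear_combination -A * sin_sq_add_cos_sq β

/-- A function `A cot + B csc + C` with `B > 0` has at most one critical point, and it is not a
local maximum. -/
theorem critical_iff_and_not_isLocalMax {f : ℝ → ℝ} {a b A B C : ℝ} (ha : 0 ≤ a) (hb : b ≤ π)
    (hB : 0 < B) (hf : ∀ β ∈ Ioo a b, f β = A * cot β + B * (sin β)⁻¹ + C) {β : ℝ}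
    (hβ : β ∈ Ioo a b) :
    (deriv f β = 0 ↔ cos β = -A / B) ∧ ¬ IsLocalMax f β := by
  have hsub : ∀ γ ∈ Ioo a b, γ ∈ Ioo 0 π := fun γ hγ => ⟨ha.trans_lt hγ.1, hγ.2.trans_le hb⟩
  have hd : ∀ γ ∈ Ioo a b, HasDerivAt f (-(A + B * cos γ) / sin γ ^ 2) γ := by
    intro γ hγ
    refine (hasDerivAt_perimeter_formula A B C (hsub γ hγ)).congr_of_eventuallyEq ?_
    filter_upwards [isOpen_Ioo.mem_nhds hγ] with x hx using hf x hx
  have hcrit : deriv f β = 0 ↔ cos β = -A / B := by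
    have hs : sin β ^ 2 ≠ 0 := pow_ne_zero 2 (sin_pos_of_mem (hsub β hβ)).ne'
    rw [(hd β hβ).deriv, div_eq_zero_iff, or_iff_left hs, neg_eq_zero, eq_div_iff hB.ne']
    constructor <;> intro h <;> linarith
  refine ⟨hcrit, fun hmax => ?_⟩
  have h0 := hcrit.1 hmax.deriv_eq_zero
  rw [eq_div_iff hB.ne'] at h0
  -- At a critical point `A + B cos β = 0`; to the right of it the cosine is smaller, so the
  -- derivative is positive.
  have hmono : StrictMonoOn f (Ico β b) := by
    refine strictMonoOn_of_deriv_pos (convex_Ico _ _) ?_ ?_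
    · exact fun x hx => (hd x ⟨hβ.1.trans_le hx.1, hx.2⟩).continuousAt.continuousWithinAt
    · intro x hx
      rw [interior_Ico] at hx
      have hx' : x ∈ Ioo a b := ⟨hβ.1.trans hx.1, hx.2⟩
      rw [(hd x hx').deriv]
      refine div_pos ?_ (pow_pos (sin_pos_of_mem (hsub x hx')) 2)
      have hcos : cos x < cos β :=
        cos_lt_cos_of_nonneg_of_le_pi (hsub β hβ).1.le (hsub x hx').2.le hx.1
      nlinarith
  have hev : ∀ᶠ x in 𝓝[>] β, f x ≤ f β := hmax.filter_mono nhdsWithin_le_nhds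
  obtain ⟨x, hx, hx'⟩ := (hev.and (Ioo_mem_nhdsGT hβ.2)).exists
  exact absurd hx (not_le.2 (hmono ⟨le_rfl, hβ.2⟩ ⟨hx'.1.le, hx'.2⟩ hx'.1))

end Angles

/-! ### The perimeter between events and its maximum -/

section Perimeter

open Real

variable {P : Finset Plane}

theorem continuousAt_slantX {β : ℝ} (hβ : β ∈ Ioo 0 π) (w : Plane) :
    ContinuousAt (fun γ => slantX γ w) β :=
  continuousAt_const.sub (continuousAt_const.mul (continuousAt_cot hβ))

theorem continuousAt_slantY {β : ℝ} (hβ : β ∈ Ioo 0 π) (w : Plane) :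
    ContinuousAt (fun γ => slantY γ w) β :=
  continuousAt_const.mul (continuous_sin.continuousAt.inv₀ (sin_pos_of_mem hβ).ne')

theorem boundaryLength_ne_top {β : ℝ} (hβ : β ∈ Ioo 0 π) : boundaryLength P β ≠ ⊤ := by
  rw [boundaryLength_eq (sin_pos_of_mem hβ)]
  exact ENNReal.add_ne_top.2 ⟨ENNReal.mul_ne_top (by simp) (volume_shadow_ne_top _ _),
    ENNReal.mul_ne_top (by simp) (volume_shadow_ne_top _ _)⟩

theorem perim_eq {β : ℝ} (hβ : β ∈ Ioo 0 π) : perim P β =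
    2 * (volume (shadow P (slantX β) height)).toReal +
      2 * (volume (shadow P height (slantX β))).toReal * (sin β)⁻¹ := by
  have hs := sin_pos_of_mem hβ
  rw [perim, boundaryLength_eq_height hs, ENNReal.toReal_add, ENNReal.toReal_mul,
    ENNReal.toReal_mul, ENNReal.toReal_mul, ENNReal.toReal_ofReal (inv_pos.2 hs).le]
  · simp only [ENNReal.toReal_ofNat]; ring
  · exact ENNReal.mul_ne_top (by simp) (volume_shadow_ne_top _ _)
  · exact ENNReal.mul_ne_top (by simp)
      (ENNReal.mul_ne_top ENNReal.ofReal_ne_top (volume_shadow_ne_top _ _))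

theorem upperSemicontinuousOn_boundaryLength :
    UpperSemicontinuousOn (boundaryLength P) (Ioo 0 π) := by
  have h1 : UpperSemicontinuousOn (fun β => volume (shadow P (slantX β) (slantY β))) (Ioo 0 π) :=
    fun β hβ => (upperSemicontinuousAt_volume_shadow (continuousAt_slantX hβ)
      (continuousAt_slantY hβ)).upperSemicontinuousWithinAt _
  have h2 : UpperSemicontinuousOn (fun β => volume (shadow P (slantY β) (slantX β))) (Ioo 0 π) :=
    fun β hβ => (upperSemicontinuousAt_volume_shadow (continuousAt_slantY hβ)
      (continuousAt_slantX hβ)).upperSemicontinuousWithinAt _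
  intro β hβ y hy
  have := ((h1.add h1).add (h2.add h2)) β hβ y
  simp only [← two_mul] at this
  rw [boundaryLength_eq (sin_pos_of_mem hβ)] at hy
  filter_upwards [this hy, self_mem_nhdsWithin] with γ hγ hγ'
  rwa [boundaryLength_eq (sin_pos_of_mem hγ')]

theorem overlaps_opposite {β : ℝ} (X : Corner) :
    overlaps P β X.opposite = Prod.swap ⁻¹' overlaps P β X := by
  have : X.opposite.opposite = X := by cases X <;> rfl
  ext t
  simp only [overlaps, mem_ofPred_eq, mem_preimage, Prod.fst_swap, Prod.snd_swap, this]
  rw [inter_comm]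
  tauto

theorem eventually_order_iff {β : ℝ} (hβ : β ∈ Ioo 0 π)
    (h : ∀ p ∈ P, ∀ q ∈ P, p ≠ q → slantX β p ≠ slantX β q) :
    ∀ᶠ γ in 𝓝 β, ∀ p ∈ P, ∀ q ∈ P, (slantX γ p < slantX γ q ↔ slantX β p < slantX β q) := by
  rw [Filter.eventually_all_finset]
  intro p hp
  rw [Filter.eventually_all_finset]
  intro q hq
  by_cases hpq : p = q
  · subst hpq; simp
  rcases lt_or_gt_of_ne (h p hp q hq hpq) with hlt | hlt
  · filter_upwards [(continuousAt_slantX hβ p).eventually_lt (continuousAt_slantX hβ q) hlt]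
      with γ hγ
    exact iff_of_true hγ hlt
  · filter_upwards [(continuousAt_slantX hβ q).eventually_lt (continuousAt_slantX hβ p) hlt]
      with γ hγ
    exact iff_of_false hγ.not_gt hlt.not_gt

/-- Vertices and overlaps depend only on the order of the points by `slantX`, which is locally
constant while the values are distinct. -/
theorem exists_slantX_eq_of_event {β : ℝ} (hβ : β ∈ events P) :
    ∃ p ∈ P, ∃ q ∈ P, p ≠ q ∧ slantX β p = slantX β q := by
  obtain ⟨hβ, hev⟩ := hβ
  by_contra! hcon
  have hord := eventually_order_iff hβ hcon
  have neg : ∀ {γ}, (∀ p ∈ P, ∀ q ∈ P, (slantX γ p < slantX γ q ↔ slantX β p < slantX β q)) →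
      ∀ p ∈ P, ∀ q ∈ P, ((-slantX γ) p < (-slantX γ) q ↔ (-slantX β) p < (-slantX β) q) := by
    intro γ h p hp q hq
    simpa using h q hq p hp
  rcases hev with ⟨X, hX⟩ | ⟨X, hX⟩
  · refine hX ?_
    filter_upwards [hord] with γ h
    cases X
    · simp only [vertices_topRight, isVertex_congr h]
    · simp only [vertices_topLeft, isVertex_congr (neg h)]
    · simp only [vertices_bottomRight, isVertex_congr h]
    · simp only [vertices_bottomLeft, isVertex_congr (neg h)]
  · refine hX ?_
    filter_upwards [hord, isOpen_Ioo.mem_nhds hβ] with γ h hγ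
    have h1 : overlaps P γ .topRight = overlaps P β .topRight := by
      rw [overlaps_topRight (sin_pos_of_mem hγ), overlaps_topRight (sin_pos_of_mem hβ),
        overlapSet_congr h]
    have h2 : overlaps P γ .topLeft = overlaps P β .topLeft := by
      rw [overlaps_topLeft (sin_pos_of_mem hγ), overlaps_topLeft (sin_pos_of_mem hβ),
        overlapSet_congr (neg h)]
    cases X
    · exact h1
    · exact h2
    · exact (overlaps_opposite .topLeft).trans ((congrArg _ h2).trans
        (overlaps_opposite .topLeft).symm)
    · exact (overlaps_opposite .topRight).trans ((congrArg _ h1).trans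
        (overlaps_opposite .topRight).symm)

theorem finite_events (hg : InjOn height P) : (events P).Finite := by
  refine Set.Finite.subset (s := ⋃ p ∈ P, ⋃ q ∈ P,
    {β | β ∈ Ioo 0 π ∧ p ≠ q ∧ slantX β p = slantX β q}) ?_ ?_
  · refine P.finite_toSet.biUnion fun p hp => P.finite_toSet.biUnion fun q hq => ?_
    refine Set.Subsingleton.finite ?_
    -- Two points at different heights determine the cotangent of the direction of their line.
    rintro β ⟨hβ, hne, h⟩ γ ⟨hγ, -, h'⟩
    have hh : p 1 - q 1 ≠ 0 := sub_ne_zero.2 fun h => hne (hg hp hq h)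
    refine cot_injOn hβ hγ (mul_left_cancel₀ hh ?_)
    simp only [slantX] at h h'
    linarith
  · intro β hβ
    obtain ⟨p, hp, q, hq, hne, h⟩ := exists_slantX_eq_of_event hβ
    simp only [mem_iUnion]
    exact ⟨p, hp, q, hq, hβ.1, hne, h⟩

/-- The perimeter between two events. -/
theorem exists_perim_formula (hg : InjOn height P) (hP : P.Nonempty) {a b : ℝ} (ha : 0 ≤ a)
    (hab : a < b) (hb : b ≤ π) (hev : ∀ β ∈ Ioo a b, β ∉ events P) :
    ∃ A B C : ℝ, 0 ≤ B ∧ (B = 0 → A = 0 ∧ C = 0) ∧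
      ∀ β ∈ Ioo a b, perim P β = A * cot β + B * (sin β)⁻¹ + C := by
  have hsub : ∀ γ ∈ Ioo a b, γ ∈ Ioo 0 π := fun γ hγ => ⟨ha.trans_lt hγ.1, hγ.2.trans_le hb⟩
  have hsin : ∀ γ ∈ Ioo a b, 0 < sin γ := fun γ hγ => sin_pos_of_mem (hsub γ hγ)
  have hvert : ∀ X, ∀ β ∈ Ioo a b, ∀ γ ∈ Ioo a b, vertices P β X = vertices P γ X := by
    intro X β hβ γ hγ
    refine eq_of_locally_eq (F := fun β => vertices P β X) (fun δ hδ => ?_) hβ hγ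
    by_contra h
    exact hev δ hδ ⟨hsub δ hδ, Or.inl ⟨X, h⟩⟩
  have hover : ∀ X, ∀ β ∈ Ioo a b, ∀ γ ∈ Ioo a b, overlaps P β X = overlaps P γ X := by
    intro X β hβ γ hγ
    refine eq_of_locally_eq (F := fun β => overlaps P β X) (fun δ hδ => ?_) hβ hγ
    by_contra h
    exact hev δ hδ ⟨hsub δ hδ, Or.inr ⟨X, h⟩⟩
  obtain ⟨β₀, hβ₀⟩ : (Ioo a b).Nonempty := nonempty_Ioo.2 hab
  have ho₁ : ∀ β ∈ Ioo a b, overlapSet P (slantX β) height = overlapSet P (slantX β₀) height := by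
    intro β hβ
    rw [← overlaps_topRight (hsin β hβ), ← overlaps_topRight (hsin β₀ hβ₀)]
    exact hover _ β hβ β₀ hβ₀
  have ho₂ : ∀ β ∈ Ioo a b,
      overlapSet P (-slantX β) height = overlapSet P (-slantX β₀) height := by
    intro β hβ
    rw [← overlaps_topLeft (hsin β hβ), ← overlaps_topLeft (hsin β₀ hβ₀)]
    exact hover _ β hβ β₀ hβ₀
  obtain ⟨p, hp, hpmin⟩ := P.exists_min_image (slantX β₀) hP
  obtain ⟨q, hq, hqmax⟩ := P.exists_max_image (slantX β₀) hP
  have hpβ : ∀ β ∈ Ioo a b, ∀ x ∈ P, slantX β p ≤ slantX β x := by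
    intro β hβ
    have h0 := (isVertex_both_iff (f := -slantX β₀) hg).2 ⟨hp, fun x hx => neg_le_neg (hpmin x hx)⟩
    have h1 : p ∈ vertices P β .topLeft := by
      rw [hvert _ β hβ β₀ hβ₀, vertices_topLeft]; exact h0.1
    have h2 : p ∈ vertices P β .bottomLeft := by
      rw [hvert _ β hβ β₀ hβ₀, vertices_bottomLeft]; exact h0.2
    rw [vertices_topLeft] at h1
    rw [vertices_bottomLeft] at h2
    exact fun x hx => neg_le_neg_iff.1 (((isVertex_both_iff hg).1 ⟨h1, h2⟩).2 x hx)
  have hqβ : ∀ β ∈ Ioo a b, ∀ x ∈ P, slantX β x ≤ slantX β q := by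
    intro β hβ
    have h0 := (isVertex_both_iff (f := slantX β₀) hg).2 ⟨hq, hqmax⟩
    have h1 : q ∈ vertices P β .topRight := by
      rw [hvert _ β hβ β₀ hβ₀, vertices_topRight]; exact h0.1
    have h2 : q ∈ vertices P β .bottomRight := by
      rw [hvert _ β hβ β₀ hβ₀, vertices_bottomRight]; exact h0.2
    rw [vertices_topRight] at h1
    rw [vertices_bottomRight] at h2
    exact ((isVertex_both_iff hg).1 ⟨h1, h2⟩).2
  set T₁ := (finite_overlapSet (P := P) (f := slantX β₀) (g := height)).toFinset
  set T₂ := (finite_overlapSet (P := P) (f := -slantX β₀) (g := height)).toFinset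
  -- The width as a linear functional of the coordinate function; applied to `slantX β`, it splits
  -- into the `w 0` part minus `cot β` times the height part.
  set L : (Plane → ℝ) → ℝ := fun u => u q - u p - ∑ t ∈ T₁, (u t.2.1 - u t.1.2) -
    ∑ t ∈ T₂, (u t.1.2 - u t.2.1) with hL
  have hwidth : ∀ β ∈ Ioo a b, (volume (shadow P (slantX β) height)).toReal =
      L (fun w => w 0) - L height * cot β := by
    intro β hβ
    have e₁ : (finite_overlapSet (P := P) (f := slantX β) (g := height)).toFinset = T₁ :=
      Set.Finite.toFinset_inj.2 (ho₁ β hβ)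
    have e₂ : (finite_overlapSet (P := P) (f := -slantX β) (g := height)).toFinset = T₂ :=
      Set.Finite.toFinset_inj.2 (ho₂ β hβ)
    rw [(volume_shadow hg hp hq (hpβ β hβ) (hqβ β hβ)).2, e₁, e₂]
    simp only [hL, slantX, height, sub_mul, Finset.sum_mul, Finset.sum_sub_distrib]
    ring
  have hheight : ∀ β ∈ Ioo a b, shadow P height (slantX β) = shadow P height (slantX β₀) :=
    fun β hβ => shadow_swap_congr hg (ho₁ β hβ) (ho₂ β hβ)
  refine ⟨-2 * L height, 2 * (volume (shadow P height (slantX β₀))).toReal,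
    2 * L (fun w => w 0), by positivity, fun hB => ?_, fun β hβ => ?_⟩
  -- With no rows there is no width, so an affine function of `cot β` vanishes at two different
  -- cotangents and both coefficients are zero.
  · have hz : ∀ β ∈ Ioo a b, L (fun w => w 0) - L height * cot β = 0 := by
      intro β hβ
      have h0 : volume (shadow P height (slantX β)) = 0 := by
        rw [hheight β hβ]
        have : (volume (shadow P height (slantX β₀))).toReal = 0 := by linarith
        exact ((ENNReal.toReal_eq_zero_iff _).1 this).resolve_right (volume_shadow_ne_top _ _)
      rw [← hwidth β hβ, volume_shadow_eq_zero hg h0, ENNReal.toReal_zero]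
    obtain ⟨β₁, hβ₁, hlt⟩ := exists_between hβ₀.2
    have hβ₁' : β₁ ∈ Ioo a b := ⟨hβ₀.1.trans hβ₁, hlt⟩
    have hne : cot β₁ - cot β₀ ≠ 0 := sub_ne_zero.2 fun h =>
      hβ₁.ne' (cot_injOn (hsub _ hβ₁') (hsub _ hβ₀) h)
    have h0 := hz β₀ hβ₀
    have h1 := hz β₁ hβ₁'
    have hh : L height = 0 := by
      have : L height * (cot β₁ - cot β₀) = 0 := by linarith
      exact (mul_eq_zero.1 this).resolve_right hne
    rw [hh] at h0 ⊢
    constructor <;> linarith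
  · rw [perim_eq (hsub β hβ), hwidth β hβ, hheight β hβ]
    ring

theorem boundaryLength_eq_zero_of_antitone (hg : InjOn height P) {β : ℝ} (hβ : β ∈ Ioo 0 π)
    {f : Plane → ℝ} (hf : f = slantX β ∨ f = -slantX β)
    (h : ∀ x ∈ P, ∀ y ∈ P, height x < height y → f y < f x) : boundaryLength P β = 0 := by
  have h1 : volume (shadow P height f) = 0 := by
    refine volume_shadow_eq_zero_of_antitone fun x hx y hy hxy => ?_
    rcases lt_trichotomy (height y) (height x) with h' | h' | h'
    · exact Or.inr h'
    · exact Or.inl (hg hx hy h'.symm)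
    · exact absurd hxy (not_le.2 (h x hx y hy h'))
  have h2 : volume (shadow P height (slantX β)) = 0 := by
    rcases hf with rfl | rfl
    · exact h1
    · rwa [shadow_neg_right] at h1
  rw [boundaryLength_eq_height (sin_pos_of_mem hβ), h2, volume_shadow_eq_zero hg h2]
  simp

/-- If the slanted lines are almost horizontal, then the hull has no boundary of positive
length. -/
theorem exists_bound_boundaryLength_eq_zero (hg : InjOn height P) :
    ∃ M : ℝ, ∀ β ∈ Ioo 0 π, M < |cot β| → boundaryLength P β = 0 := by
  obtain ⟨M, hM⟩ := ((P.finite_toSet.prod P.finite_toSet).image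
    fun z : Plane × Plane => |(z.2 0 - z.1 0) / (z.2 1 - z.1 1)|).bddAbove
  have hM' : ∀ x ∈ P, ∀ y ∈ P, height x < height y → |y 0 - x 0| ≤ M * (y 1 - x 1) := by
    intro x hx y hy hxy
    have hpos : 0 < y 1 - x 1 := sub_pos.2 hxy
    have : |(y 0 - x 0) / (y 1 - x 1)| ≤ M := hM ⟨(x, y), ⟨hx, hy⟩, rfl⟩
    rwa [abs_div, abs_of_pos hpos, div_le_iff₀ hpos] at this
  refine ⟨M, fun β hβ hc => ?_⟩
  rcases lt_abs.1 hc with h | h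
  · refine boundaryLength_eq_zero_of_antitone hg hβ (Or.inl rfl) fun x hx y hy hxy => ?_
    have h1 := le_of_abs_le (hM' x hx y hy hxy)
    have h2 := mul_lt_mul_of_pos_right h (sub_pos.2 hxy)
    simp only [slantX, height] at h2 ⊢
    linarith
  · refine boundaryLength_eq_zero_of_antitone hg hβ (Or.inr rfl) fun x hx y hy hxy => ?_
    have h1 := neg_le_of_abs_le (hM' x hx y hy hxy)
    have h2 := mul_lt_mul_of_pos_right h (sub_pos.2 hxy)
    simp only [slantX, height, Pi.neg_apply] at h2 ⊢
    linarith

theorem exists_boundaryLength_pos (hg : InjOn height P) (hcard : 2 ≤ P.card) :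
    ∃ β ∈ Ioo 0 π, boundaryLength P β ≠ 0 := by
  obtain ⟨p, hp, q, hq, hne⟩ := Finset.one_lt_card.1 hcard
  wlog hlt : height p < height q generalizing p q
  · exact this q hq p hp hne.symm
      (lt_of_le_of_ne (not_lt.1 hlt) fun h => hne (hg hp hq h.symm))
  -- The direction of the line through `p` and `q`: every height between them is then in the shadow.
  refine ⟨arccot ((q 0 - p 0) / (q 1 - p 1)), arccot_mem _, fun h0 => ?_⟩
  set β := arccot ((q 0 - p 0) / (q 1 - p 1)) with hβ
  have hs : 0 < sin β := sin_pos_of_mem (arccot_mem _)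
  have hpos : 0 < q 1 - p 1 := sub_pos.2 hlt
  have heq : slantX β q = slantX β p := by
    simp only [slantX, hβ, cot_arccot]
    field_simp
    ring
  rw [boundaryLength_eq_height hs, add_eq_zero] at h0
  have h1 : volume (shadow P height (slantX β)) = 0 := by
    have := h0.2
    simpa [hs] using this
  have h2 := measure_mono_null (Icc_subset_shadow hq hp hq hp heq.le heq.ge le_rfl le_rfl le_rfl
    le_rfl) h1
  rw [Real.volume_Icc, ENNReal.ofReal_eq_zero] at h2
  simp only [height] at h2
  linarith

theorem exists_isMaxOn_perim (hg : InjOn height P) :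
    ∃ β ∈ Ioo 0 π, IsMaxOn (perim P) (Ioo 0 π) β := by
  obtain ⟨M, hM⟩ := exists_bound_boundaryLength_eq_zero hg
  have hK : arccot '' Icc (-|M|) |M| ⊆ Ioo 0 π := by
    rintro _ ⟨c, -, rfl⟩; exact arccot_mem c
  -- The bound `M` is not known to be nonnegative, whence `|M|`.
  have hne : (arccot '' Icc (-|M|) |M|).Nonempty := ⟨arccot 0, 0, ⟨by simp, by simp⟩, rfl⟩
  obtain ⟨β, hβ, hmax⟩ := ((upperSemicontinuousOn_boundaryLength (P := P)).mono hK).exists_isMaxOn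
    hne (isCompact_Icc.image continuous_arccot)
  refine ⟨β, hK hβ, fun γ hγ => ?_⟩
  refine ENNReal.toReal_mono (boundaryLength_ne_top (hK hβ)) ?_
  by_cases h : |cot γ| ≤ |M|
  · exact hmax ⟨cot γ, abs_le.1 h, arccot_cot hγ⟩
  · rw [hM γ hγ ((le_abs_self M).trans_lt (not_le.1 h))]
    exact zero_le

theorem mem_events_of_isMaxOn (hg : InjOn height P) (hcard : 2 ≤ P.card) {β : ℝ}
    (hβ : β ∈ Ioo 0 π) (hmax : IsMaxOn (perim P) (Ioo 0 π) β) : β ∈ events P := by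
  by_contra hev
  have hnhds : Ioo 0 π ∩ (events P)ᶜ ∈ 𝓝 β := inter_mem (isOpen_Ioo.mem_nhds hβ)
    ((finite_events hg).isClosed.isOpen_compl.mem_nhds hev)
  obtain ⟨a, b, hβab, hab⟩ := mem_nhds_iff_exists_Ioo_subset.1 hnhds
  have hlt := hβab.1.trans hβab.2
  -- Passing to closures yields `0 ≤ a` and `b ≤ π`.
  have hcl := closure_mono (fun γ hγ => (hab hγ).1 : Ioo a b ⊆ Ioo 0 π)
  rw [closure_Ioo hlt.ne, closure_Ioo pi_pos.ne] at hcl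
  have ha := (hcl (left_mem_Icc.2 hlt.le)).1
  have hb := (hcl (right_mem_Icc.2 hlt.le)).2
  obtain ⟨A, B, C, hB, hB0, hf⟩ := exists_perim_formula hg
    (Finset.card_pos.1 (by omega)) ha hlt hb fun γ hγ => (hab hγ).2
  rcases hB.eq_or_lt with h | h
  · obtain ⟨γ, hγ, hne⟩ := exists_boundaryLength_pos hg hcard
    have h1 : perim P γ ≤ perim P β := hmax hγ
    have h2 : 0 < perim P γ := ENNReal.toReal_pos hne (boundaryLength_ne_top hγ)
    rw [hf β hβab, (hB0 h.symm).1, (hB0 h.symm).2, ← h] at h1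
    linarith
  · exact (critical_iff_and_not_isLocalMax ha hb h hf hβab).2
      (hmax.isLocalMax (isOpen_Ioo.mem_nhds hβ))

end Perimeter

end OBeta

theorem mainTheorem7 (P : Finset OBeta.Plane) (hcard : 2 ≤ P.card)
    (hcol : ∀ p ∈ P, ∀ q ∈ P, ∀ r ∈ P, p ≠ q → p ≠ r → q ≠ r →
      ¬ Collinear ℝ ({p, q, r} : Set OBeta.Plane))
    (hhor : ∀ p ∈ P, ∀ q ∈ P, p ≠ q → p 1 ≠ q 1) :
    -- the events form a finite sequence, and perimeters are finite
    (OBeta.events P).Finite ∧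
    (∀ β ∈ Ioo 0 Real.pi, OBeta.boundaryLength P β ≠ ⊤) ∧
    -- the maximum over all angles is attained, at an event, and only at events
    (∃ β ∈ OBeta.events P, IsMaxOn (OBeta.perim P) (Ioo 0 Real.pi) β) ∧
    (∀ β ∈ Ioo 0 Real.pi, IsMaxOn (OBeta.perim P) (Ioo 0 Real.pi) β → β ∈ OBeta.events P) ∧
    -- the perimeter on an interval between events
    (∀ a b : ℝ, 0 ≤ a → a < b → b ≤ Real.pi → (∀ β ∈ Ioo a b, β ∉ OBeta.events P) →
      ∃ A B C : ℝ, 0 ≤ B ∧ (B = 0 → A = 0 ∧ C = 0) ∧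
        (∀ β ∈ Ioo a b,
          OBeta.perim P β = A * Real.cot β + B * (Real.sin β)⁻¹ + C) ∧
        (0 < B → ∀ β ∈ Ioo a b,
          (deriv (OBeta.perim P) β = 0 ↔ Real.cos β = -A / B) ∧
          ¬ IsLocalMax (OBeta.perim P) β)) := by
  have hg : InjOn OBeta.height P := fun p hp q hq h => by
    by_contra hne
    exact hhor p hp q hq hne h
  refine ⟨OBeta.finite_events hg, fun β hβ => OBeta.boundaryLength_ne_top hβ, ?_,
    fun β hβ hmax => OBeta.mem_events_of_isMaxOn hg hcard hβ hmax, fun a b ha hab hb hev => ?_⟩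
  · obtain ⟨β, hβ, hmax⟩ := OBeta.exists_isMaxOn_perim hg
    exact ⟨β, OBeta.mem_events_of_isMaxOn hg hcard hβ hmax, hmax⟩
  · obtain ⟨A, B, C, hB, hB0, hf⟩ :=
      OBeta.exists_perim_formula hg (Finset.card_pos.1 (by omega)) ha hab hb hev
    exact ⟨A, B, C, hB, hB0, hf, fun hpos β hβ =>
      OBeta.critical_iff_and_not_isLocalMax ha hb hpos hf hβ⟩
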